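/- Let $n\ge 1$ be an integer, $\alpha>0$ and $1<p<n/\alpha$. Write $X\prec Y$ if $X\le cY$ with a constant $c$, and $X\approx Y$ if $X\prec Y$ and $Y\prec X$. Let $\Psi$ be a function from $[0,\infty)$ onto itself such that (i) $\Psi\approx\widetilde\Psi$ for some strictly increasing $\widetilde\Psi:[0,\infty)\to[0,\infty)$; (ii) $\Psi(0)=0$, and for each $c>0$, $\Psi(cs)\approx\Psi(s)$ for $s\ge 0$, with constants that may depend on $c$; (iii) $\displaystyle\int_0^s\Big(\frac{\Psi(u)}{u}\Big)^{1/p}\frac{du}{u}\prec\Big(\frac{\Psi(s)}{s}\Big)^{1/p}$ for all $s>0$, with a constant independent of $s$. Put $w_\alpha(r)=r^{n-\alpha p}$ for $0<r<1$ and $w_\alpha(r)=r^n$ for $r\ge1$. For an open set $O\subset\mathbf R^n$ let $TO=\{(x,t): x\in O,\ 0<t<\operatorname{dist}(x,\partial O)\}$ be the tent over $O$ (with $\operatorname{dist}(x,\emptyset)=\infty$). Let $\Lambda^\infty_{w_\alpha}(O)=\inf\sum_j w_\alpha(r_j)$, the infimum being over all coverings of $O$ by countably many balls of radii $r_j>0$.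 Let $$cap(O;H^\alpha_p)=\inf\{\|f\|_{H^\alpha_p}^p:\ f\in\mathcal S(\mathbf R^n),\ f\ge0,\ f\ge1\text{ on }O\}\qquad(\inf\emptyset=\infty),$$ where $\|f\|_{H^\alpha_p}=\|g\|_{L^p}$ if $f=G_\alpha*g$ with $g\in L^p(\mathbf R^n)$, and $G_\alpha(x)=|x|^{(\alpha-n)/2}K_{(n-\alpha)/2}(|x|)$ is the Bessel kernel, $K_\nu$ being the modified Bessel function of the third kind. For a set function $\kappa$ on open sets with values in $[0,\infty]$, let $Cap^\Psi(\kappa)$ be the class of positive Borel measures $\mu$ on $\mathbf R^{n+1}_+=\mathbf R^n\times(0,\infty)$ for which there is a constant $c<\infty$ with $\mu(TO)\le c\,\Psi(\kappa(O))$ for all open sets $O\subset\mathbf R^n$, where $\Psi(\infty)=\infty$ (no condition if $\kappa(O)=\infty$). Write $Cap^\Psi(\Lambda^\infty_{w_\alpha})$ and $Cap^\Psi(H^\alpha_p)$ for the classes given by $\kappa=\Lambda^\infty_{w_\alpha}$ and $\kappa=cap(\,\cdot\,;H^\alpha_p)$. For $\Phi:[0,\infty)\to[0,\infty)$ let $C^\Phi$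 be the class of positive Borel measures $\mu$ on $\mathbf R^{n+1}_+$ for which there is a constant $c<\infty$ with $\mu(TB)\le c\,\Phi(r)$ for all $r>0$ and all balls $B\subset\mathbf R^n$ of radius $r$. Then $$Cap^\Psi(\Lambda^\infty_{w_\alpha})=Cap^\Psi(H^\alpha_p)=C^{\Psi\circ w_\alpha}.$$ -/

import Mathlib

open MeasureTheory Set
open scoped ENNReal NNReal SchwartzMap

noncomputable section

/-- The upper half-space `ℝⁿ × (0, ∞)`, with its Borel σ-algebra. -/
abbrev UpperSpace (n : ℕ) : Type := EuclideanSpace ℝ (Fin n) × Set.Ioi (0 : ℝ)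

/-- The tent `{(x, t) : x ∈ O, 0 < t < dist (x, ∂O)}` over `O`. The distance to the empty set
is `∞`, so that the tent over the whole space is the whole half-space. -/
def tent {n : ℕ} (O : Set (EuclideanSpace ℝ (Fin n))) : Set (UpperSpace n) :=
  {q | q.1 ∈ O ∧ ENNReal.ofReal (q.2 : ℝ) < Metric.infEDist q.1 (frontier O)}

/-- `X ≈ Y`: each of the two functions is at most a constant multiple of the other. -/
def Comparable (X Y : ℝ≥0 → ℝ≥0) : Prop :=
  ∃ c : ℝ≥0, ∀ s, X s ≤ c * Y s ∧ Y s ≤ c * X s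

/-- `Ψ(0) = 0` and `Ψ(cs) ≈ Ψ(s)` for each `c > 0`, with constants that may depend on `c`. -/
def DilationCondition (Ψ : ℝ≥0 → ℝ≥0) : Prop :=
  Ψ 0 = 0 ∧ ∀ c : ℝ≥0, 0 < c → Comparable (fun s => Ψ (c * s)) Ψ

/-- `∫₀ˢ (Ψ(u)/u)^(1/p) du/u ≤ C (Ψ(s)/s)^(1/p)` for all `s > 0`, with `C` independent of `s`. -/
def DiniCondition (p : ℝ) (Ψ : ℝ≥0 → ℝ≥0) : Prop :=
  ∃ C : ℝ≥0, ∀ s : ℝ≥0, 0 < s →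
    ∫⁻ u in Set.Ioo (0 : ℝ) s, ENNReal.ofReal (((Ψ u.toNNReal : ℝ) / u) ^ (1 / p) / u)
      ≤ C * ENNReal.ofReal (((Ψ s : ℝ) / s) ^ (1 / p))

/-- The modified Bessel function of the third kind `K_ν(r)`, for `ν > -1/2` and `r > 0`. -/
def besselK (ν r : ℝ) : ℝ :=
  √(Real.pi / 2) / Real.Gamma (ν + 1 / 2) * r ^ (-(1 / 2) : ℝ) * Real.exp (-r) *
    ∫ u in Set.Ioi (0 : ℝ),
      Real.exp (-u) * u ^ (ν - 1 / 2) * (1 + u / (2 * r)) ^ (ν - 1 / 2)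

/-- The Bessel kernel `G_α(x) = |x|^((α-n)/2) K_((n-α)/2)(|x|)` on `ℝⁿ`, `0 < α < n`. -/
def besselKernel (n : ℕ) (α : ℝ) (x : EuclideanSpace ℝ (Fin n)) : ℝ :=
  ‖x‖ ^ ((α - n) / 2) * besselK ((n - α) / 2) ‖x‖

/-- The Bessel potential `G_α * g`. -/
def besselPotential (n : ℕ) (α : ℝ) (g : EuclideanSpace ℝ (Fin n) → ℝ)
    (x : EuclideanSpace ℝ (Fin n)) : ℝ :=
  ∫ y, besselKernel n α (x - y) * g y

/-- The norm of `f` in the Bessel potential space `H^α_p`: `‖g‖_{L^p}` if `f = G_α * g` almost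
everywhere with `g ∈ L^p` (such a `g` is unique), and `∞` if there is no such `g`. -/
def besselNorm (n : ℕ) (α p : ℝ) (f : EuclideanSpace ℝ (Fin n) → ℝ) : ℝ≥0∞ :=
  ⨅ (g : EuclideanSpace ℝ (Fin n) → ℝ) (_ : MemLp g (ENNReal.ofReal p) volume)
    (_ : f =ᵐ[volume] besselPotential n α g), eLpNorm g (ENNReal.ofReal p) volume

/-- The Bessel capacity `cap(O; H^α_p)`; it is `∞` if no Schwartz function is admissible. -/
def besselCapacity (n : ℕ) (α p : ℝ) (O : Set (EuclideanSpace ℝ (Fin n))) : ℝ≥0∞ :=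
  ⨅ (f : 𝓢(EuclideanSpace ℝ (Fin n), ℝ)) (_ : ∀ x, 0 ≤ f x) (_ : ∀ x ∈ O, 1 ≤ f x),
    besselNorm n α p f ^ p

/-- The `w`-Hausdorff capacity: the infimum of `∑ w(r_j)` over all countable families of balls
(center, radius) whose union contains `O`. -/
def hausdorffCapacity (n : ℕ) (w : ℝ≥0 → ℝ≥0) (O : Set (EuclideanSpace ℝ (Fin n))) : ℝ≥0∞ :=
  ⨅ (S : Set (EuclideanSpace ℝ (Fin n) × ℝ≥0)) (_ : S.Countable) (_ : ∀ b ∈ S, 0 < b.2)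
    (_ : O ⊆ ⋃ b ∈ S, Metric.ball b.1 (b.2 : ℝ)), ∑' b : S, (w b.1.2 : ℝ≥0∞)

/-- The class of measures `μ` with `μ(TO) ≤ c Φ(cap O)` uniformly for all open sets `O`. Where
the capacity is infinite the right-hand side is read as `∞`, so there is no condition. -/
def CapClass {n : ℕ} (Φ : ℝ≥0 → ℝ≥0) (cap : Set (EuclideanSpace ℝ (Fin n)) → ℝ≥0∞) :
    Set (Measure (UpperSpace n)) :=
  {μ | ∃ c : ℝ≥0, ∀ O : Set (EuclideanSpace ℝ (Fin n)), IsOpen O → cap O ≠ ∞ →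
    μ (tent O) ≤ c * Φ (cap O).toNNReal}

/-- The Carleson-type class `C^Φ`: `μ(TB) ≤ c Φ(r)` uniformly for all balls `B` of radius `r`. -/
def CarlesonClass (n : ℕ) (Φ : ℝ≥0 → ℝ≥0) : Set (Measure (UpperSpace n)) :=
  {μ | ∃ c : ℝ≥0, ∀ (x : EuclideanSpace ℝ (Fin n)) (r : ℝ≥0), 0 < r →
    μ (tent (Metric.ball x (r : ℝ))) ≤ c * Φ r}

/-- `w_α(r) = r^(n-αp)` for `r < 1` and `r^n` for `r ≥ 1`. -/
def wAlpha (n : ℕ) (α p : ℝ) (r : ℝ≥0) : ℝ≥0 :=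
  if r < 1 then r ^ ((n : ℝ) - α * p) else r ^ (n : ℝ)

end

/-! The conditions and the classes are unchanged when Ψ is replaced by a comparable increasing Φ. A
measure in either capacity class is of Carleson type because a ball of radius r has both capacities
at most a multiple of w(r) = w_α(r) (`capClass_subset_carlesonClass`): it covers itself, and G_α
convolved with a scaled bump is admissible for it (`exists_besselCapacity_ball_le`). The content is
in the two converses.

Hausdorff capacity. The Dini condition makes Φ(u)/u almost increasing, so ∑ Φ(w(r_j)) is at most a
multiple of Φ(∑ w(r_j)). The tents over dilated balls of a cover of O need not cover the tent over
O, since a high point may stand above many small balls. A Vitali selection of balls inside O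
supplies the missing tents, and their total weight does not exceed that of the cover
(`exists_tent_cover`).

Bessel capacity. The argument is dual (`exists_rpow_le_of_carleson`). Let A ⊆ TO have finite mass M
≈ Φ(s), and let h ≥ 0 satisfy G_α * h ≥ 1 on O. Averaging over B(x,t) for (x,t) in A gives 1 ≤ C ∫
τ(max(t,|x-y|)) h(y) dy with τ(r) = min(r^(α-n), r^(-n)). Integrate over A and use τ(m) ≤ C ∫_m^∞
τ(r) dr/r: then M is at most a multiple of ∫ τ(r) ∫ h N_r dy dr/r, where N_r(y) is the mass that A
has in the cylinder of radius and height r at y. Here N_r ≤ C min(M, Φ(w(r))) and ∫ N_r ≤ C M r^n.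
With q conjugate to p, Hölder and τ(r) r^(n/q) = w(r)^(-1/p) leave M^(1/q) ‖h‖_p times the integral
of (min(M, Φ(w))/w)^(1/p) dr/r, which the Dini condition bounds by a multiple of (M/s)^(1/p). The
powers of M cancel and s ≤ C ‖h‖_p^p remains; the infimum over h gives s ≤ C cap(O), hence M ≤ C
Φ(cap(O)). -/

/-! ### Geometry of tents -/

section Tents

variable {n : ℕ}

lemma isOpen_tent {O : Set (EuclideanSpace ℝ (Fin n))} (hO : IsOpen O) : IsOpen (tent O) := by
  refine (hO.preimage continuous_fst).inter
    (isOpen_lt (f := fun q : UpperSpace n => ENNReal.ofReal (q.2 : ℝ))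
      (g := fun q : UpperSpace n => Metric.infEDist q.1 (frontier O)) ?_ ?_)
  · exact ENNReal.continuous_ofReal.comp (continuous_subtype_val.comp continuous_snd)
  · exact Metric.continuous_infEDist.comp continuous_fst

/-- The ball is connected, meets O at its center and misses the boundary of O, so it cannot leave O.
-/
lemma ball_subset_of_mem_tent {O : Set (EuclideanSpace ℝ (Fin n))} {q : UpperSpace n}
    (hq : q ∈ tent O) : Metric.ball q.1 (q.2 : ℝ) ⊆ O := by
  have hpos : (0 : ℝ) < q.2 := q.2.2
  have hd : ∀ y ∈ Metric.ball q.1 (q.2 : ℝ), y ∉ frontier O := fun y hy hyO => by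
    have h1 := hq.2.trans_le (Metric.infEDist_le_edist_of_mem hyO)
    rw [edist_dist, ENNReal.ofReal_lt_ofReal_iff_of_nonneg hpos.le, dist_comm] at h1
    exact lt_asymm h1 (Metric.mem_ball.1 hy)
  have hconn : IsPreconnected (Metric.ball q.1 (q.2 : ℝ)) := (convex_ball _ _).isPreconnected
  by_contra hcon
  obtain ⟨y, hy, hyO⟩ := not_subset.1 hcon
  obtain ⟨z, hz, hzf⟩ := hconn (interior O) (closure O)ᶜ isOpen_interior isClosed_closure.isOpen_compl
      (fun z hz => by
        by_contra hzn
        simp only [mem_union, not_or, mem_compl_iff, not_not] at hzn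
        exact hd z hz ⟨hzn.2, hzn.1⟩)
      ⟨q.1, Metric.mem_ball_self hpos, by
        by_contra hzn
        exact hd _ (Metric.mem_ball_self hpos) ⟨subset_closure hq.1, hzn⟩⟩
      ⟨y, hy, fun hyc => hd y hy ⟨hyc, fun h => hyO (interior_subset h)⟩⟩
  exact hzf.2 (interior_subset_closure hzf.1)

lemma mem_tent_ball {q : UpperSpace n} {x : EuclideanSpace ℝ (Fin n)} {r : ℝ}
    (h : dist q.1 x + q.2 < r) : q ∈ tent (Metric.ball x r) := by
  have hpos : (0 : ℝ) < q.2 := q.2.2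
  refine ⟨by rw [Metric.mem_ball]; linarith, ?_⟩
  have h1 : ENNReal.ofReal (r - dist q.1 x) ≤ Metric.infEDist q.1 (frontier (Metric.ball x r)) := by
    rw [Metric.le_infEDist]
    intro y hy
    have hy' : dist y x = r := Metric.mem_sphere.1 (Metric.frontier_ball_subset_sphere hy)
    rw [edist_dist]
    refine ENNReal.ofReal_le_ofReal ?_
    have := dist_triangle y q.1 x
    rw [dist_comm y q.1] at this
    linarith
  refine lt_of_lt_of_le ?_ h1
  rw [ENNReal.ofReal_lt_ofReal_iff_of_nonneg hpos.le]
  linarith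

end Tents

/-! ### The weight w_α -/

section Weight

variable {n : ℕ} {α p : ℝ}

lemma wAlpha_of_lt {r : ℝ≥0} (h : r < 1) : wAlpha n α p r = r ^ ((n : ℝ) - α * p) := by
  simp [wAlpha, h]

lemma wAlpha_of_le {r : ℝ≥0} (h : 1 ≤ r) : wAlpha n α p r = r ^ n := by
  simp [wAlpha, not_lt.2 h]

lemma wAlpha_of_le_one {r : ℝ≥0} (h : r ≤ 1) : wAlpha n α p r = r ^ ((n : ℝ) - α * p) := by
  rcases h.lt_or_eq with h | rfl
  · exact wAlpha_of_lt h
  · simp [wAlpha]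

lemma wAlpha_pos {r : ℝ≥0} (h : 0 < r) : 0 < wAlpha n α p r := by
  unfold wAlpha; split_ifs <;> exact NNReal.rpow_pos h

/-- The density `w_α(r) / rⁿ` is decreasing. -/
lemma wAlpha_mul_pow_le (hαp : 0 ≤ α * p) {r s : ℝ≥0} (hr : 0 < r) (hrs : r ≤ s) :
    wAlpha n α p s * r ^ n ≤ wAlpha n α p r * s ^ n := by
  have key : ∀ t : ℝ≥0, 0 < t → t ≤ 1 → wAlpha n α p t = t ^ n * t ^ (-(α * p)) := by
    intro t ht h1
    rw [wAlpha_of_le_one h1, sub_eq_add_neg, NNReal.rpow_add ht.ne', NNReal.rpow_natCast]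
  rcases le_or_gt s 1 with hs | hs
  · rw [key s (hr.trans_le hrs) hs, key r hr (hrs.trans hs)]
    have : s ^ (-(α * p)) ≤ r ^ (-(α * p)) := by
      rw [NNReal.rpow_neg, NNReal.rpow_neg]
      exact inv_anti₀ (NNReal.rpow_pos hr) (NNReal.rpow_le_rpow hrs hαp)
    calc s ^ n * s ^ (-(α * p)) * r ^ n ≤ s ^ n * r ^ (-(α * p)) * r ^ n := by gcongr
      _ = _ := by ring
  · rw [wAlpha_of_le hs.le, mul_comm]
    gcongr
    rcases le_or_gt r 1 with h1 | h1
    · rw [key r hr h1]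
      refine le_mul_of_one_le_right' ?_
      exact NNReal.one_le_rpow_of_pos_of_le_one_of_nonpos hr h1 (by linarith)
    · rw [wAlpha_of_le h1.le]

lemma wAlpha_mul_le (hαp : 0 ≤ α * p) {c r : ℝ≥0} (hc : 1 ≤ c) (hr : 0 < r) :
    wAlpha n α p (c * r) ≤ c ^ n * wAlpha n α p r := by
  have := wAlpha_mul_pow_le (n := n) hαp hr (le_mul_of_one_le_left' hc : r ≤ c * r)
  rw [mul_pow, ← mul_assoc, mul_comm (wAlpha n α p r)] at this
  exact le_of_mul_le_mul_right this (pow_pos hr _)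

end Weight

/-! ### Comparable gauges and the Dini condition -/

section Gauge

variable {Φ Ψ : ℝ≥0 → ℝ≥0} {p : ℝ}

lemma Comparable.symm (h : Comparable Ψ Φ) : Comparable Φ Ψ := by
  obtain ⟨c, hc⟩ := h
  exact ⟨c, fun s => (hc s).symm⟩

lemma Comparable.trans {X Y Z : ℝ≥0 → ℝ≥0} (h : Comparable X Y) (h' : Comparable Y Z) :
    Comparable X Z := by
  obtain ⟨c, hc⟩ := h
  obtain ⟨d, hd⟩ := h'
  refine ⟨c * d, fun s => ⟨(hc s).1.trans ?_, (hd s).2.trans ?_⟩⟩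
  · rw [mul_assoc]; gcongr; exact (hd s).1
  · rw [mul_comm c, mul_assoc]; gcongr; exact (hc s).2

lemma DilationCondition.of_comparable (hΨ : DilationCondition Ψ) (h : Comparable Ψ Φ) :
    DilationCondition Φ := by
  obtain ⟨c, hc⟩ := id h
  refine ⟨?_, fun d hd => ?_⟩
  · have := (hc 0).2
    rwa [hΨ.1, mul_zero, nonpos_iff_eq_zero] at this
  · exact (Comparable.trans ⟨c, fun s => (hc (d * s)).symm⟩ (hΨ.2 d hd)).trans h

lemma div_rpow_le_mul_div_rpow {a b c u : ℝ} (hp : 0 < p) (ha : 0 ≤ a) (hc : 0 ≤ c) (hb : 0 ≤ b)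
    (hu : 0 < u) (h : a ≤ c * b) : (a / u) ^ (1 / p) ≤ c ^ (1 / p) * (b / u) ^ (1 / p) := by
  rw [← Real.mul_rpow hc (by positivity)]
  refine Real.rpow_le_rpow (by positivity) ?_ (by positivity)
  rw [← mul_div_assoc]
  gcongr

lemma DiniCondition.of_comparable (hp : 0 < p) (hΨ : DiniCondition p Ψ) (h : Comparable Ψ Φ) :
    DiniCondition p Φ := by
  obtain ⟨c, hc⟩ := h
  obtain ⟨C, hC⟩ := hΨ
  have hc' : ∀ s : ℝ≥0, (Ψ s : ℝ) ≤ c * Φ s ∧ (Φ s : ℝ) ≤ c * Ψ s := fun s => by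
    exact_mod_cast hc s
  refine ⟨c ^ (1 / p) * C * c ^ (1 / p), fun s hs => ?_⟩
  have hcr : ENNReal.ofReal ((c : ℝ) ^ (1 / p)) = ((c ^ (1 / p) : ℝ≥0) : ℝ≥0∞) := by
    rw [← NNReal.coe_rpow, ENNReal.ofReal_coe_nnreal]
  calc ∫⁻ u in Ioo (0 : ℝ) s, ENNReal.ofReal (((Φ u.toNNReal : ℝ) / u) ^ (1 / p) / u)
      ≤ ∫⁻ u in Ioo (0 : ℝ) s, ((c ^ (1 / p) : ℝ≥0) : ℝ≥0∞) *
          ENNReal.ofReal (((Ψ u.toNNReal : ℝ) / u) ^ (1 / p) / u) := by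
        refine setLIntegral_mono' measurableSet_Ioo fun u hu => ?_
        rw [← hcr, ← ENNReal.ofReal_mul (by positivity), ← mul_div_assoc]
        refine ENNReal.ofReal_le_ofReal (div_le_div_of_nonneg_right ?_ hu.1.le)
        exact div_rpow_le_mul_div_rpow hp (by positivity) (by positivity) (by positivity) hu.1
          (hc' _).2
    _ = ((c ^ (1 / p) : ℝ≥0) : ℝ≥0∞) *
          ∫⁻ u in Ioo (0 : ℝ) s, ENNReal.ofReal (((Ψ u.toNNReal : ℝ) / u) ^ (1 / p) / u) :=
        lintegral_const_mul' _ _ ENNReal.coe_ne_top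
    _ ≤ ((c ^ (1 / p) : ℝ≥0) : ℝ≥0∞) * (C * (((c ^ (1 / p) : ℝ≥0) : ℝ≥0∞) *
          ENNReal.ofReal (((Φ s : ℝ) / s) ^ (1 / p)))) := by
        gcongr
        refine (hC s hs).trans ?_
        gcongr
        rw [← hcr, ← ENNReal.ofReal_mul (by positivity)]
        refine ENNReal.ofReal_le_ofReal ?_
        exact div_rpow_le_mul_div_rpow hp (by positivity) (by positivity) (by positivity)
          (by exact_mod_cast hs) (hc' _).1
    _ = _ := by push_cast; ring

/-- Under the Dini condition `Φ(u) / u` is almost increasing. -/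
lemma DiniCondition.almost_increasing (hp : 0 < p) (hmono : Monotone Φ)
    (hdil : DilationCondition Φ) (h : DiniCondition p Φ) :
    ∃ C : ℝ≥0, ∀ u s : ℝ≥0, u ≤ s → Φ u * s ≤ C * Φ s * u := by
  obtain ⟨C, hC⟩ := h
  obtain ⟨c, hc⟩ := hdil.2 (1 / 2) (by positivity)
  refine ⟨c * (2 * C) ^ p, fun u s hus => ?_⟩
  rcases eq_or_lt_of_le (zero_le (a := u)) with rfl | hu
  · simp [hdil.1]
  have hs : 0 < s := hu.trans_le hus
  have hu' : (0 : ℝ) < u := by exact_mod_cast hu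
  have hs' : (0 : ℝ) < s := by exact_mod_cast hs
  -- Only the part of the Dini integral over (u/2, u) is kept; there Φ(v) ≥ Φ(u/2) and 1/v ≥ 1/u.
  -- The dilation condition later returns from Φ(u/2) to Φ(u).
  have h1 : ENNReal.ofReal (((Φ (1 / 2 * u) : ℝ) / u) ^ (1 / p) / u) * ENNReal.ofReal (u - u / 2)
      ≤ ∫⁻ v in Ioo (0 : ℝ) s, ENNReal.ofReal (((Φ v.toNNReal : ℝ) / v) ^ (1 / p) / v) := by
    rw [← Real.volume_Ioo, ← setLIntegral_const]
    refine le_trans (setLIntegral_mono' measurableSet_Ioo fun v hv => ?_)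
      (lintegral_mono_set (Ioo_subset_Ioo (by positivity) (by exact_mod_cast hus)))
    have hv0 : 0 < v := by linarith [hv.1]
    refine ENNReal.ofReal_le_ofReal ?_
    have h2 : (Φ (1 / 2 * u) : ℝ) ≤ Φ v.toNNReal := by
      refine NNReal.coe_le_coe.2 (hmono ?_)
      rw [← NNReal.coe_le_coe, Real.coe_toNNReal _ hv0.le]
      push_cast; linarith [hv.1]
    have hvu : v ≤ u := hv.2.le
    gcongr
  have h3 := h1.trans (hC s hs)
  rw [← ENNReal.ofReal_mul (by positivity), ← ENNReal.ofReal_coe_nnreal,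
    ← ENNReal.ofReal_mul (by positivity), ENNReal.ofReal_le_ofReal_iff (by positivity)] at h3
  have h4 : ((Φ (1 / 2 * u) : ℝ) / u) ^ (1 / p) ≤ 2 * C * ((Φ s : ℝ) / s) ^ (1 / p) := by
    have : ((Φ (1 / 2 * u) : ℝ) / u) ^ (1 / p) / u * (u - u / 2)
        = ((Φ (1 / 2 * u) : ℝ) / u) ^ (1 / p) / 2 := by field_simp; ring
    rw [this] at h3
    linarith
  have h5 : (Φ (1 / 2 * u) : ℝ) / u ≤ (2 * C) ^ p * ((Φ s : ℝ) / s) := by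
    have := Real.rpow_le_rpow (by positivity) h4 hp.le
    rwa [Real.mul_rpow (by positivity) (by positivity), ← Real.rpow_mul (by positivity),
      ← Real.rpow_mul (by positivity), one_div_mul_cancel hp.ne', Real.rpow_one,
      Real.rpow_one] at this
  have h6 : (Φ u : ℝ) ≤ c * Φ (1 / 2 * u) := by exact_mod_cast (hc u).2
  rw [← NNReal.coe_le_coe]
  push_cast
  rw [div_le_iff₀ hu'] at h5
  calc (Φ u : ℝ) * s ≤ c * ((2 * C) ^ p * ((Φ s : ℝ) / s) * u) * s := by
        gcongr; exact h6.trans (by gcongr)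
    _ = _ := by field_simp

end Gauge

/-! ### Covering of tents and the Hausdorff capacity -/

section HausdorffCovering

variable {n : ℕ} {α p : ℝ}

lemma volume_ball_eq_pow_mul (x : EuclideanSpace ℝ (Fin n)) {r : ℝ≥0} (hr : 0 < r) :
    volume (Metric.ball x (r : ℝ)) =
      (r : ℝ≥0∞) ^ n * volume (Metric.ball (0 : EuclideanSpace ℝ (Fin n)) 1) := by
  rw [Measure.addHaar_ball_of_pos _ _ (by exact_mod_cast hr), finrank_euclideanSpace,
    Fintype.card_fin, ENNReal.ofReal_pow r.coe_nonneg, ENNReal.ofReal_coe_nnreal]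

lemma wAlpha_div_mul_volume_ball (x : EuclideanSpace ℝ (Fin n)) {r : ℝ≥0} (hr : 0 < r) :
    ((wAlpha n α p r / r ^ n : ℝ≥0) : ℝ≥0∞) * volume (Metric.ball x (r : ℝ)) =
      wAlpha n α p r * volume (Metric.ball (0 : EuclideanSpace ℝ (Fin n)) 1) := by
  rw [volume_ball_eq_pow_mul x hr, ← mul_assoc, ← ENNReal.coe_pow, ← ENNReal.coe_mul,
    div_mul_cancel₀ _ (pow_pos hr n).ne']

/-- Up to a constant, w(r) is the density w(r)/rⁿ times the volume of the ball. On each intersection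
with a ball of the cover the density of the selected ball is the smaller one, because its radius is
larger and densities decrease. Since the selected balls are disjoint, each ball of the cover is
charged at most its own volume. -/
lemma tsum_wAlpha_le_of_pairwiseDisjoint (hαp : 0 ≤ α * p)
    {S : Set (EuclideanSpace ℝ (Fin n) × ℝ≥0)} (hS : S.Countable) (hpos : ∀ b ∈ S, 0 < b.2)
    {u : Set (EuclideanSpace ℝ (Fin n) × ℝ≥0)} (hu : u.Countable) (hupos : ∀ q ∈ u, 0 < q.2)
    (hcov : ∀ q ∈ u, Metric.ball q.1 (q.2 : ℝ) ⊆ ⋃ b ∈ S, Metric.ball b.1 (b.2 : ℝ))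
    (hsmall : ∀ q ∈ u, ∀ b ∈ S,
      (Metric.ball q.1 (q.2 : ℝ) ∩ Metric.ball b.1 (b.2 : ℝ)).Nonempty → b.2 ≤ q.2)
    (hdisj : u.PairwiseDisjoint fun q => Metric.ball q.1 (q.2 : ℝ)) :
    ∑' q : u, (wAlpha n α p q.1.2 : ℝ≥0∞) ≤ ∑' b : S, (wAlpha n α p b.1.2 : ℝ≥0∞) := by
  set v : ℝ≥0∞ := volume (Metric.ball (0 : EuclideanSpace ℝ (Fin n)) 1) with hv
  have hv0 : v ≠ 0 := (Metric.measure_ball_pos _ _ one_pos).ne'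
  have hvt : v ≠ ∞ := measure_ball_lt_top.ne
  have := hS.to_subtype
  have := hu.to_subtype
  let B : EuclideanSpace ℝ (Fin n) × ℝ≥0 → Set (EuclideanSpace ℝ (Fin n)) :=
    fun q => Metric.ball q.1 (q.2 : ℝ)
  have hBm : ∀ q, MeasurableSet (B q) := fun q => measurableSet_ball
  let φ : ℝ≥0 → ℝ≥0 := fun r => wAlpha n α p r / r ^ n
  have h1 : ∀ q : u, (wAlpha n α p q.1.2 : ℝ≥0∞) * v
      ≤ ∑' b : S, (φ b.1.2 : ℝ≥0∞) * volume (B q ∩ B b) := by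
    intro q
    have hq0 := hupos q q.2
    rw [← wAlpha_div_mul_volume_ball q.1.1 hq0]
    have hsub : B q ⊆ ⋃ b : S, B q ∩ B b := by
      rw [← inter_iUnion]
      refine subset_inter subset_rfl ((hcov q q.2).trans ?_)
      rw [biUnion_eq_iUnion]
    calc ((wAlpha n α p q.1.2 / q.1.2 ^ n : ℝ≥0) : ℝ≥0∞) * volume (B q)
        ≤ (φ q.1.2 : ℝ≥0∞) * ∑' b : S, volume (B q ∩ B b) := by
          gcongr
          exact (measure_mono hsub).trans (measure_iUnion_le _)
      _ = ∑' b : S, (φ q.1.2 : ℝ≥0∞) * volume (B q ∩ B b) := ENNReal.tsum_mul_left.symm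
      _ ≤ _ := by
          refine ENNReal.tsum_le_tsum fun b => ?_
          rcases eq_empty_or_nonempty (B q ∩ B b) with he | hne
          · simp [he]
          gcongr
          have hb0 := hpos b b.2
          rw [div_le_div_iff₀ (pow_pos hq0 n) (pow_pos hb0 n)]
          exact wAlpha_mul_pow_le hαp hb0 (hsmall q q.2 b b.2 hne)
  have h2 : (∑' q : u, (wAlpha n α p q.1.2 : ℝ≥0∞)) * v
      ≤ (∑' b : S, (wAlpha n α p b.1.2 : ℝ≥0∞)) * v := by
    rw [← ENNReal.tsum_mul_right, ← ENNReal.tsum_mul_right]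
    refine (ENNReal.tsum_le_tsum h1).trans ?_
    rw [ENNReal.tsum_comm]
    refine ENNReal.tsum_le_tsum fun b => ?_
    rw [ENNReal.tsum_mul_left, ← wAlpha_div_mul_volume_ball b.1.1 (hpos b b.2)]
    gcongr
    rw [← measure_iUnion ?_ fun q => (hBm _).inter (hBm _)]
    · exact measure_mono (iUnion_subset fun q => inter_subset_right)
    · intro q q' hne
      exact (hdisj q.2 q'.2 (fun h => hne (Subtype.ext h))).mono inter_subset_left inter_subset_left
  exact (ENNReal.mul_le_mul_iff_left hv0 hvt).1 h2

/-- A cover of `O` by balls of finite total weight gives a cover of the tent over `O` by tents over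
dilated balls of comparable total weight. -/
lemma exists_tent_cover (hn : n ≠ 0) (hαp : 0 ≤ α * p) {O : Set (EuclideanSpace ℝ (Fin n))}
    {S : Set (EuclideanSpace ℝ (Fin n) × ℝ≥0)} (hS : S.Countable) (hpos : ∀ b ∈ S, 0 < b.2)
    (hcov : O ⊆ ⋃ b ∈ S, Metric.ball b.1 (b.2 : ℝ))
    (hfin : ∑' b : S, (wAlpha n α p b.1.2 : ℝ≥0∞) ≠ ∞) :
    ∃ u : Set (EuclideanSpace ℝ (Fin n) × ℝ≥0), u.Countable ∧ (∀ q ∈ u, 0 < q.2) ∧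
      tent O ⊆ (⋃ b ∈ S, tent (Metric.ball b.1 ((6 * b.2 : ℝ≥0) : ℝ))) ∪
        ⋃ q ∈ u, tent (Metric.ball q.1 ((6 * q.2 : ℝ≥0) : ℝ)) ∧
      ∑' q : u, (wAlpha n α p q.1.2 : ℝ≥0∞) ≤ ∑' b : S, (wAlpha n α p b.1.2 : ℝ≥0∞) := by
  let B : EuclideanSpace ℝ (Fin n) × ℝ≥0 → Set (EuclideanSpace ℝ (Fin n)) :=
    fun q => Metric.ball q.1 (q.2 : ℝ)
  -- The balls inside O that no larger ball of the cover meets. A point of the tent whose own ball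
  -- meets a larger ball of the cover already lies in the tent over the dilate of the latter.
  let t : Set (EuclideanSpace ℝ (Fin n) × ℝ≥0) :=
    {q | 0 < q.2 ∧ B q ⊆ O ∧ ∀ b ∈ S, (B q ∩ B b).Nonempty → b.2 ≤ q.2}
  set σ := ∑' b : S, (wAlpha n α p b.1.2 : ℝ≥0∞)
  -- The Vitali lemma needs bounded radii. The disjointness estimate for one ball gives w(r) ≤ σ,
  -- and w(r) = rⁿ ≥ r once r ≥ 1.
  have hbdd : ∀ q ∈ t, (q.2 : ℝ) ≤ max 1 σ.toReal := by
    intro q hq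
    have h1 := tsum_wAlpha_le_of_pairwiseDisjoint (u := {q}) hαp hS hpos (countable_singleton q)
      (by rintro _ rfl; exact hq.1) (by rintro _ rfl; exact hq.2.1.trans hcov)
      (by rintro _ rfl; exact hq.2.2) (pairwiseDisjoint_singleton _ _)
    rw [tsum_singleton (f := fun q : EuclideanSpace ℝ (Fin n) × ℝ≥0 =>
      (wAlpha n α p q.2 : ℝ≥0∞))] at h1
    rcases le_total q.2 1 with h | h
    · exact le_max_of_le_left (by exact_mod_cast h)
    · refine le_max_of_le_right ?_
      rw [wAlpha_of_le h] at h1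
      have h2 := (ENNReal.toReal_le_toReal ENNReal.coe_ne_top hfin).2 h1
      refine le_trans ?_ h2
      rw [ENNReal.coe_toReal, NNReal.coe_le_coe]
      exact le_self_pow₀ h hn
  obtain ⟨u, hut, hdisj, hu⟩ := Vitali.exists_disjoint_subfamily_covering_enlargement B t
    (fun q => (q.2 : ℝ)) 2 one_lt_two (fun q _ => q.2.2) _ hbdd
    (fun q hq => ⟨q.1, Metric.mem_ball_self (by exact_mod_cast hq.1)⟩)
  have huc : u.Countable := hdisj.countable_of_isOpen (fun q _ => Metric.isOpen_ball)
    (fun q hq => ⟨q.1, Metric.mem_ball_self (by exact_mod_cast (hut hq).1)⟩)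
  refine ⟨u, huc, fun q hq => (hut hq).1, ?_, tsum_wAlpha_le_of_pairwiseDisjoint hαp hS hpos huc
    (fun q hq => (hut hq).1) (fun q hq => (hut hq).2.1.trans hcov) (fun q hq => (hut hq).2.2) hdisj⟩
  intro z hz
  have hz0 : (0 : ℝ) < z.2 := z.2.2
  -- Distance to the center of b plus height is below twice the height plus the radius, so at most 5
  -- radii when the height is at most 2 radii; 6 suffices.
  have hmem : ∀ b : EuclideanSpace ℝ (Fin n) × ℝ≥0,
      (Metric.ball z.1 (z.2 : ℝ) ∩ B b).Nonempty → (z.2 : ℝ) ≤ 2 * b.2 →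
      z ∈ tent (Metric.ball b.1 ((6 * b.2 : ℝ≥0) : ℝ)) := by
    rintro b ⟨y, hy, hyb⟩ hle
    refine mem_tent_ball ?_
    have h1 := dist_triangle z.1 y b.1
    rw [Metric.mem_ball, dist_comm] at hy
    have h2 : dist y b.1 < b.2 := hyb
    push_cast
    linarith
  by_cases hzt : ∃ b ∈ S, (Metric.ball z.1 (z.2 : ℝ) ∩ B b).Nonempty ∧ (z.2 : ℝ) < b.2
  · obtain ⟨b, hb, hne, hlt⟩ := hzt
    refine Or.inl (mem_biUnion hb (hmem b hne ?_))
    linarith [b.2.2]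
  · push Not at hzt
    have hzt' : ((z.1, ⟨z.2, hz0.le⟩) : EuclideanSpace ℝ (Fin n) × ℝ≥0) ∈ t :=
      ⟨hz0, ball_subset_of_mem_tent hz, fun b hb hne => hzt b hb hne⟩
    obtain ⟨b, hb, hne, hle⟩ := hu _ hzt'
    exact Or.inr (mem_biUnion hb (hmem b hne hle))

lemma exists_measure_tent_ball_le {Φ : ℝ≥0 → ℝ≥0} (hmono : Monotone Φ)
    (hdil : DilationCondition Φ) (hαp : 0 ≤ α * p) (k : ℝ≥0)
    (hk : 1 ≤ k) {μ : Measure (UpperSpace n)} (hμ : μ ∈ CarlesonClass n (Φ ∘ wAlpha n α p)) :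
    ∃ C : ℝ≥0, ∀ (x : EuclideanSpace ℝ (Fin n)) (r : ℝ≥0), 0 < r →
      μ (tent (Metric.ball x ((k * r : ℝ≥0) : ℝ))) ≤ C * Φ (wAlpha n α p r) := by
  obtain ⟨c, hc⟩ := hμ
  obtain ⟨d, hd⟩ := hdil.2 (k ^ n) (by positivity)
  refine ⟨c * d, fun x r hr => (hc x (k * r) (by positivity)).trans ?_⟩
  rw [ENNReal.coe_mul, mul_assoc]
  gcongr
  exact_mod_cast (hmono (wAlpha_mul_le hαp hk hr)).trans (hd _).1

lemma carlesonClass_subset_capClass_hausdorffCapacity (hn : n ≠ 0) (hαp : 0 ≤ α * p)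
    {q : ℝ} (hq : 0 < q) {Φ : ℝ≥0 → ℝ≥0} (hmono : Monotone Φ)
    (hdil : DilationCondition Φ) (hdini : DiniCondition q Φ) :
    CarlesonClass n (Φ ∘ wAlpha n α p) ⊆ CapClass Φ (hausdorffCapacity n (wAlpha n α p)) := by
  intro μ hμ
  obtain ⟨C, hC⟩ := exists_measure_tent_ball_le hmono hdil hαp 6 (by norm_num) hμ
  obtain ⟨D, hD⟩ := hdini.almost_increasing hq hmono hdil
  -- Superadditivity up to constants: each weight is at most σ, so almost monotonicity bounds Φ(w)
  -- by D Φ(σ) w/σ, which is linear in w and can be summed.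
  have hsum : ∀ {σ : ℝ≥0} {S : Set (EuclideanSpace ℝ (Fin n) × ℝ≥0)}, S.Countable →
      (∀ b ∈ S, 0 < b.2) → 0 < σ → ∑' b : S, (wAlpha n α p b.1.2 : ℝ≥0∞) ≤ σ →
      μ (⋃ b ∈ S, tent (Metric.ball b.1 ((6 * b.2 : ℝ≥0) : ℝ))) ≤ C * D * Φ σ := by
    intro σ S hS hpos hσ hle
    have := hS.to_subtype
    have h1 : ∀ b : S, μ (tent (Metric.ball b.1.1 ((6 * b.1.2 : ℝ≥0) : ℝ)))
        ≤ ((C * D * Φ σ / σ : ℝ≥0) : ℝ≥0∞) * wAlpha n α p b.1.2 := by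
      intro b
      refine (hC b.1.1 b.1.2 (hpos b b.2)).trans ?_
      rw [← ENNReal.coe_mul, ← ENNReal.coe_mul, ENNReal.coe_le_coe]
      have hbσ : wAlpha n α p b.1.2 ≤ σ :=
        ENNReal.coe_le_coe.1 ((ENNReal.le_tsum b).trans hle)
      have h2 := hD _ _ hbσ
      rw [div_mul_eq_mul_div, le_div_iff₀ hσ]
      calc C * Φ (wAlpha n α p b.1.2) * σ = C * (Φ (wAlpha n α p b.1.2) * σ) := by ring
        _ ≤ C * (D * Φ σ * wAlpha n α p b.1.2) := by gcongr
        _ = _ := by ring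
    rw [biUnion_eq_iUnion]
    refine (measure_iUnion_le _).trans ((ENNReal.tsum_le_tsum h1).trans ?_)
    rw [ENNReal.tsum_mul_left]
    refine (mul_le_mul_right hle _).trans ?_
    rw [← ENNReal.coe_mul, div_mul_cancel₀ _ hσ.ne']
    push_cast; rfl
  have hmain : ∀ (O : Set (EuclideanSpace ℝ (Fin n))) (σ : ℝ≥0),
      hausdorffCapacity n (wAlpha n α p) O < σ → μ (tent O) ≤ (2 * C * D) * Φ σ := by
    intro O σ hlt
    simp only [hausdorffCapacity, iInf_lt_iff] at hlt
    obtain ⟨S, hS, hpos, hcov, hlt⟩ := hlt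
    have hσ : 0 < σ := by exact_mod_cast (zero_le (a := _)).trans_lt hlt
    obtain ⟨u, hu, hupos, hsub, hle⟩ := exists_tent_cover hn hαp hS hpos hcov hlt.ne_top
    calc μ (tent O) ≤ _ := measure_mono hsub
      _ ≤ _ := measure_union_le _ _
      _ ≤ C * D * Φ σ + C * D * Φ σ :=
        add_le_add (hsum hS hpos hσ hlt.le) (hsum hu hupos hσ (hle.trans hlt.le))
      _ = _ := by ring
  obtain ⟨d, hd⟩ := hdil.2 2 (by positivity)
  refine ⟨2 * C * D * d, fun O _ hO => ?_⟩
  -- Near-optimal covers with sum below 2κ exist only if κ > 0. At capacity zero the tent must be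
  -- shown to be null, which follows from Φ(ε) ≤ D Φ(1) ε as ε tends to 0.
  rcases eq_or_ne (hausdorffCapacity n (wAlpha n α p) O) 0 with h0 | h0
  · have h1 : ∀ ε : ℝ≥0, 0 < ε → ε ≤ 1 → μ (tent O) ≤ (2 * C * D * (D * Φ 1)) * ε := by
      intro ε hε hε1
      refine (hmain O ε (by rw [h0]; exact_mod_cast hε)).trans ?_
      have := hD ε 1 hε1
      rw [mul_one] at this
      rw [mul_assoc _ _ (ε : ℝ≥0∞)]
      gcongr
      exact_mod_cast this
    have h2 : μ (tent O) ≤ 0 := by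
      have hlim : Filter.Tendsto
          (fun ε : ℝ≥0 => ((2 * C * D * (D * Φ 1) : ℝ≥0) : ℝ≥0∞) * (ε : ℝ≥0∞))
          (nhdsWithin 0 (Ioi 0)) (nhds 0) := by
        have : Filter.Tendsto (fun ε : ℝ≥0 => (((2 * C * D * (D * Φ 1)) * ε : ℝ≥0) : ℝ≥0∞))
            (nhdsWithin 0 (Ioi 0)) (nhds (((2 * C * D * (D * Φ 1)) * 0 : ℝ≥0) : ℝ≥0∞)) := by
          refine ENNReal.tendsto_coe.2 (Filter.Tendsto.mono_left ?_ nhdsWithin_le_nhds)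
          exact (continuous_const.mul continuous_id).tendsto 0
        simpa using this
      refine ge_of_tendsto hlim ?_
      filter_upwards [Ioc_mem_nhdsGT (zero_lt_one' ℝ≥0)] with ε hε
      refine (h1 ε hε.1 hε.2).trans (le_of_eq ?_)
      push_cast; rfl
    exact h2.trans (zero_le (a := _))
  · set κ := (hausdorffCapacity n (wAlpha n α p) O).toNNReal with hκ
    have hκ' : hausdorffCapacity n (wAlpha n α p) O = κ := (ENNReal.coe_toNNReal hO).symm
    have hκ0 : 0 < κ := ENNReal.toNNReal_pos h0 hO
    refine (hmain O (2 * κ) ?_).trans ?_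
    · rw [hκ', ENNReal.coe_lt_coe]
      exact lt_mul_of_one_lt_left hκ0 one_lt_two
    · have := (hd κ).1
      simp only at this
      push_cast
      rw [mul_assoc _ (d : ℝ≥0∞)]
      gcongr
      exact_mod_cast this

lemma capClass_subset_carlesonClass {Φ : ℝ≥0 → ℝ≥0} (hmono : Monotone Φ)
    (hdil : DilationCondition Φ) {w : ℝ≥0 → ℝ≥0}
    {cap : Set (EuclideanSpace ℝ (Fin n)) → ℝ≥0∞} {k : ℝ≥0}
    (h : ∀ x (r : ℝ≥0), 0 < r → cap (Metric.ball x (r : ℝ)) ≤ k * w r) :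
    CapClass Φ cap ⊆ CarlesonClass n (Φ ∘ w) := by
  rintro μ ⟨c, hc⟩
  obtain ⟨d, hd⟩ := hdil.2 (k + 1) (by positivity)
  refine ⟨c * d, fun x r hr => ?_⟩
  have h1 : cap (Metric.ball x (r : ℝ)) ≤ ((k * w r : ℝ≥0) : ℝ≥0∞) := by
    push_cast; exact h x r hr
  have hne : cap (Metric.ball x (r : ℝ)) ≠ ∞ := ne_top_of_le_ne_top ENNReal.coe_ne_top h1
  refine (hc _ Metric.isOpen_ball hne).trans ?_
  rw [ENNReal.coe_mul, mul_assoc]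
  gcongr
  have h2 : (cap (Metric.ball x (r : ℝ))).toNNReal ≤ (k + 1) * w r :=
    (ENNReal.toNNReal_mono ENNReal.coe_ne_top h1).trans (by
      rw [ENNReal.toNNReal_coe]; gcongr; exact le_self_add)
  exact_mod_cast (hmono h2).trans (hd _).1

lemma hausdorffCapacity_ball_le {w : ℝ≥0 → ℝ≥0} (x : EuclideanSpace ℝ (Fin n)) {r : ℝ≥0}
    (hr : 0 < r) : hausdorffCapacity n w (Metric.ball x (r : ℝ)) ≤ w r := by
  refine (iInf₂_le {(x, r)} (countable_singleton _)).trans ?_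
  refine (iInf₂_le (by rintro _ rfl; exact hr) (by simp)).trans ?_
  rw [tsum_singleton (f := fun q : EuclideanSpace ℝ (Fin n) × ℝ≥0 => (w q.2 : ℝ≥0∞))]

end HausdorffCovering

/-! ### Pointwise bounds and moments of the Bessel kernel -/

section BesselKernel

lemma exists_one_add_rpow_mul_exp_le {s ε : ℝ} (hs : 0 ≤ s) (hε : 0 < ε) :
    ∃ C : ℝ, 0 < C ∧ ∀ r : ℝ, 0 ≤ r → (1 + r) ^ s * Real.exp (-(ε * r)) ≤ C := by
  set t := s + 1 with ht
  have ht0 : 0 < t := by positivity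
  set M := max 1 (t / ε)
  have hM1 : 1 ≤ M := le_max_left _ _
  have hM2 : t / ε ≤ M := le_max_right _ _
  refine ⟨M ^ t, by positivity, fun r hr => ?_⟩
  rw [Real.exp_neg, ← div_eq_mul_inv, div_le_iff₀ (Real.exp_pos _)]
  have h1 : 1 + r ≤ M * Real.exp (ε / t * r) := by
    have h2 := Real.add_one_le_exp (ε / t * r)
    have h3 : r ≤ M * (ε / t * r) := by
      calc r = (t / ε) * (ε / t * r) := by field_simp
        _ ≤ _ := by gcongr
    calc 1 + r ≤ M * (ε / t * r + 1) := by linarith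
      _ ≤ _ := by gcongr
  calc (1 + r) ^ s ≤ (1 + r) ^ t := Real.rpow_le_rpow_of_exponent_le (by linarith) (by linarith)
    _ ≤ (M * Real.exp (ε / t * r)) ^ t := Real.rpow_le_rpow (by linarith) h1 ht0.le
    _ = M ^ t * Real.exp (ε * r) := by
      rw [Real.mul_rpow (by positivity) (by positivity), ← Real.exp_mul]
      congr 2; field_simp

/-- For β ≥ 0, 1 + u/(2r) ≤ (1+r)(1+u)/r separates the variables. For β < 0 the summand 1 is
dropped, which leaves u^(2β), integrable at 0 precisely because β > -1/2. -/
lemma exists_integrableOn_besselK_bound {β : ℝ} (hβ : -(1 / 2) < β) :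
    ∃ h : ℝ → ℝ, IntegrableOn h (Ioi 0) ∧ ∀ r u : ℝ, 0 < r → 0 < u →
      Real.exp (-u) * u ^ β * (1 + u / (2 * r)) ^ β ≤ r ^ (-β) * (1 + r) ^ |β| * h u := by
  rcases le_or_gt 0 β with h0 | h0
  · refine ⟨fun u => 2 ^ β * (Real.exp (-u) * u ^ ((β + 1) - 1) +
      Real.exp (-u) * u ^ ((2 * β + 1) - 1)), ?_, fun r u hr hu => ?_⟩
    · exact ((Real.GammaIntegral_convergent (by linarith)).add
        (Real.GammaIntegral_convergent (by linarith))).const_mul _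
    · rw [abs_of_nonneg h0, add_sub_cancel_right, add_sub_cancel_right]
      have h1 : (1 + u / (2 * r)) ^ β ≤ r ^ (-β) * (1 + r) ^ β * (1 + u) ^ β := by
        rw [Real.rpow_neg hr.le, ← Real.inv_rpow hr.le, ← Real.mul_rpow (by positivity)
          (by positivity), ← Real.mul_rpow (by positivity) (by positivity)]
        refine Real.rpow_le_rpow (by positivity) ?_ h0
        rw [inv_mul_eq_div, div_mul_eq_mul_div, le_div_iff₀ hr]
        have : (1 + u / (2 * r)) * r = r + u / 2 := by field_simp
        rw [this]
        nlinarith [mul_pos hr hu]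
      have h2 : (1 + u) ^ β ≤ 2 ^ β * (1 + u ^ β) := by
        rcases le_total u 1 with h | h
        · calc (1 + u) ^ β ≤ 2 ^ β := Real.rpow_le_rpow (by positivity) (by linarith) h0
            _ ≤ _ := le_mul_of_one_le_right (by positivity) (by linarith [Real.rpow_nonneg hu.le β])
        · calc (1 + u) ^ β ≤ (2 * u) ^ β := Real.rpow_le_rpow (by positivity) (by linarith) h0
            _ = 2 ^ β * u ^ β := Real.mul_rpow (by positivity) hu.le
            _ ≤ _ := by gcongr; linarith
      have h3 : u ^ (2 * β) = u ^ β * u ^ β := by rw [two_mul, Real.rpow_add hu]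
      calc Real.exp (-u) * u ^ β * (1 + u / (2 * r)) ^ β
          ≤ Real.exp (-u) * u ^ β * (r ^ (-β) * (1 + r) ^ β * (2 ^ β * (1 + u ^ β))) := by
            gcongr
            exact h1.trans (by gcongr)
        _ = _ := by simp only [h3]; ring
  · refine ⟨fun u => 2 ^ (-β) * (Real.exp (-u) * u ^ ((2 * β + 1) - 1)), ?_, fun r u hr hu => ?_⟩
    · exact (Real.GammaIntegral_convergent (by linarith)).const_mul _
    · rw [add_sub_cancel_right]
      have h1 : (1 + u / (2 * r)) ^ β ≤ u ^ β * (2 ^ (-β) * r ^ (-β)) := by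
        calc (1 + u / (2 * r)) ^ β ≤ (u / (2 * r)) ^ β :=
              Real.rpow_le_rpow_of_nonpos (by positivity) (by linarith) h0.le
          _ = _ := by
            rw [Real.div_rpow hu.le (by positivity), Real.mul_rpow (by positivity) hr.le,
              Real.rpow_neg hr.le, Real.rpow_neg (by positivity)]
            field_simp
      have h2 : (1 : ℝ) ≤ (1 + r) ^ |β| := Real.one_le_rpow (by linarith) (abs_nonneg _)
      have h3 : u ^ (2 * β) = u ^ β * u ^ β := by rw [two_mul, Real.rpow_add hu]
      calc Real.exp (-u) * u ^ β * (1 + u / (2 * r)) ^ β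
          ≤ Real.exp (-u) * u ^ β * (u ^ β * (2 ^ (-β) * r ^ (-β))) := by gcongr
        _ = r ^ (-β) * 1 * (2 ^ (-β) * (Real.exp (-u) * u ^ (2 * β))) := by simp only [h3]; ring
        _ ≤ _ := by gcongr

lemma measurable_besselKernel (n : ℕ) (α : ℝ) : Measurable (besselKernel n α) := by
  have h1 : Measurable (besselK ((n - α) / 2)) := by
    unfold besselK
    refine Measurable.mul (by fun_prop) ?_
    refine (StronglyMeasurable.integral_prod_right (f := fun r u : ℝ =>
      Real.exp (-u) * u ^ (((n : ℝ) - α) / 2 - 1 / 2) *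
        (1 + u / (2 * r)) ^ (((n : ℝ) - α) / 2 - 1 / 2)) ?_).measurable
    refine Measurable.stronglyMeasurable ?_
    unfold Function.uncurry
    fun_prop
  unfold besselKernel
  exact (by fun_prop : Measurable fun x : EuclideanSpace ℝ (Fin n) => ‖x‖ ^ ((α - n) / 2)).mul
    (h1.comp measurable_norm)

lemma besselKernel_nonneg {n : ℕ} {α : ℝ} (hα : α < n) (x : EuclideanSpace ℝ (Fin n)) :
    0 ≤ besselKernel n α x := by
  unfold besselKernel besselK
  have h1 : 0 ≤ Real.Gamma ((n - α) / 2 + 1 / 2) :=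
    Real.Gamma_nonneg_of_nonneg (by linarith)
  have h2 : 0 ≤ ∫ u in Ioi (0 : ℝ), Real.exp (-u) * u ^ (((n : ℝ) - α) / 2 - 1 / 2) *
      (1 + u / (2 * ‖x‖)) ^ (((n : ℝ) - α) / 2 - 1 / 2) := by
    refine setIntegral_nonneg measurableSet_Ioi fun u hu => ?_
    have : (0 : ℝ) < u := hu
    positivity
  positivity

lemma besselKernel_eq {n : ℕ} {α : ℝ} {x : EuclideanSpace ℝ (Fin n)} (hx : x ≠ 0) :
    besselKernel n α x = √(Real.pi / 2) / Real.Gamma ((n - α) / 2 + 1 / 2) *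
      ‖x‖ ^ ((α - n) / 2 - 1 / 2) * Real.exp (-‖x‖) *
      ∫ u in Ioi (0 : ℝ), Real.exp (-u) * u ^ (((n : ℝ) - α) / 2 - 1 / 2) *
        (1 + u / (2 * ‖x‖)) ^ (((n : ℝ) - α) / 2 - 1 / 2) := by
  have hr : 0 < ‖x‖ := norm_pos_iff.2 hx
  unfold besselKernel besselK
  rw [sub_eq_add_neg ((α - n) / 2) (1 / 2), Real.rpow_add hr]
  ring

lemma exists_besselKernel_le {n : ℕ} {α : ℝ} (hα : α < n) :
    ∃ C : ℝ, 0 < C ∧ ∀ x : EuclideanSpace ℝ (Fin n), x ≠ 0 →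
      besselKernel n α x ≤ C * (‖x‖ ^ (α - n) * Real.exp (-(1 / 2 * ‖x‖))) := by
  set β : ℝ := (n - α) / 2 - 1 / 2 with hβ
  obtain ⟨h, hint, hh⟩ := exists_integrableOn_besselK_bound (β := β) (by linarith)
  obtain ⟨K, hK, hKb⟩ := exists_one_add_rpow_mul_exp_le (abs_nonneg β) (one_half_pos (α := ℝ))
  have hG : 0 < Real.Gamma ((n - α) / 2 + 1 / 2) := Real.Gamma_pos_of_pos (by linarith)
  set c := √(Real.pi / 2) / Real.Gamma ((n - α) / 2 + 1 / 2) with hc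
  have hc0 : 0 < c := div_pos (Real.sqrt_pos.2 (by positivity)) hG
  set A := |∫ u in Ioi (0 : ℝ), h u| + 1
  have hA : 0 < A := by positivity
  refine ⟨c * A * K, by positivity, fun x hx => ?_⟩
  have hr : 0 < ‖x‖ := norm_pos_iff.2 hx
  rw [besselKernel_eq hx, ← hc, ← hβ]
  have h1 : ∫ u in Ioi (0 : ℝ), Real.exp (-u) * u ^ β * (1 + u / (2 * ‖x‖)) ^ β
      ≤ ‖x‖ ^ (-β) * (1 + ‖x‖) ^ |β| * A := by
    calc _ ≤ ∫ u in Ioi (0 : ℝ), ‖x‖ ^ (-β) * (1 + ‖x‖) ^ |β| * h u := by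
          refine integral_mono_of_nonneg ?_ (hint.const_mul _) ?_
          · refine (ae_restrict_iff' measurableSet_Ioi).2 (ae_of_all _ fun u hu => ?_)
            have : (0 : ℝ) < u := hu
            simp only [Pi.zero_apply]
            positivity
          · exact (ae_restrict_iff' measurableSet_Ioi).2 (ae_of_all _ fun u hu => hh _ u hr hu)
      _ ≤ _ := by
          rw [integral_const_mul]
          gcongr
          exact (le_abs_self _).trans (by simp [A])
  -- One half of the decay absorbs the factor (1+‖x‖)^|β|, the other half stays in the bound.
  have h2 : Real.exp (-‖x‖) = Real.exp (-(1 / 2 * ‖x‖)) * Real.exp (-(1 / 2 * ‖x‖)) := by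
    rw [← Real.exp_add]; congr 1; ring
  have h3 : ‖x‖ ^ ((α - n) / 2 - 1 / 2) * ‖x‖ ^ (-β) = ‖x‖ ^ (α - n) := by
    rw [← Real.rpow_add hr]; congr 1; rw [hβ]; ring
  calc c * ‖x‖ ^ ((α - n) / 2 - 1 / 2) * Real.exp (-‖x‖) * _
      ≤ c * ‖x‖ ^ ((α - n) / 2 - 1 / 2) * Real.exp (-‖x‖) *
        (‖x‖ ^ (-β) * (1 + ‖x‖) ^ |β| * A) := by gcongr
    _ = c * A * ((1 + ‖x‖) ^ |β| * Real.exp (-(1 / 2 * ‖x‖))) *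
        (‖x‖ ^ (α - n) * Real.exp (-(1 / 2 * ‖x‖))) := by rw [h2, ← h3]; ring
    _ ≤ _ := by
      gcongr
      exact hKb _ hr.le

/-- The part u ∈ (1, 2] of the integral suffices: there u and ‖x‖ + u/2 lie between 1/2 and 2 or a
little inside, so their β-th powers are bounded below for either sign of β. -/
lemma exists_le_besselKernel {n : ℕ} {α : ℝ} (hα : α < n) :
    ∃ c : ℝ, 0 < c ∧ ∀ x : EuclideanSpace ℝ (Fin n), x ≠ 0 → ‖x‖ ≤ 1 →
      c * ‖x‖ ^ (α - n) ≤ besselKernel n α x := by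
  set β : ℝ := (n - α) / 2 - 1 / 2 with hβ
  obtain ⟨h, hint, hh⟩ := exists_integrableOn_besselK_bound (β := β) (by linarith)
  have hG : 0 < Real.Gamma ((n - α) / 2 + 1 / 2) := Real.Gamma_pos_of_pos (by linarith)
  set c := √(Real.pi / 2) / Real.Gamma ((n - α) / 2 + 1 / 2) with hc
  have hc0 : 0 < c := div_pos (Real.sqrt_pos.2 (by positivity)) hG
  set m : ℝ := Real.exp (-2) * 2 ^ (-|β|) * 2 ^ (-|β|)
  refine ⟨c * Real.exp (-1) * m, by positivity, fun x hx hx1 => ?_⟩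
  have hr : 0 < ‖x‖ := norm_pos_iff.2 hx
  rw [besselKernel_eq hx, ← hc, ← hβ]
  have hpow : ∀ y : ℝ, 1 / 2 ≤ y → y ≤ 2 → (2 : ℝ) ^ (-|β|) ≤ y ^ β := by
    intro y h1 h2
    have hy : 0 < y := by linarith
    rcases le_total 0 β with h0 | h0
    · rw [abs_of_nonneg h0, Real.rpow_neg two_pos.le, ← Real.inv_rpow two_pos.le]
      exact Real.rpow_le_rpow (by positivity) (by linarith) h0
    · rw [abs_of_nonpos h0, neg_neg]
      exact Real.rpow_le_rpow_of_nonpos hy h2 h0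
  have hmeas : Measurable fun u : ℝ => Real.exp (-u) * u ^ β * (1 + u / (2 * ‖x‖)) ^ β := by
    fun_prop
  have hF : IntegrableOn (fun u : ℝ => Real.exp (-u) * u ^ β * (1 + u / (2 * ‖x‖)) ^ β) (Ioi 0) := by
    refine Integrable.mono' (hint.const_mul (‖x‖ ^ (-β) * (1 + ‖x‖) ^ |β|))
      hmeas.aestronglyMeasurable ?_
    refine (ae_restrict_iff' measurableSet_Ioi).2 (ae_of_all _ fun u hu => ?_)
    have : (0 : ℝ) < u := hu
    rw [Real.norm_of_nonneg (by positivity)]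
    exact hh _ u hr hu
  have h1 : m * ‖x‖ ^ (-β) ≤
      ∫ u in Ioi (0 : ℝ), Real.exp (-u) * u ^ β * (1 + u / (2 * ‖x‖)) ^ β := by
    have h2 : ∫ u in Ioc (1 : ℝ) 2, m * ‖x‖ ^ (-β) = m * ‖x‖ ^ (-β) := by
      rw [setIntegral_const]; norm_num
    rw [← h2]
    have hsub : Ioc (1 : ℝ) 2 ⊆ Ioi 0 := fun u hu => lt_trans zero_lt_one hu.1
    calc _ ≤ ∫ u in Ioc (1 : ℝ) 2, Real.exp (-u) * u ^ β * (1 + u / (2 * ‖x‖)) ^ β := by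
          refine setIntegral_mono_on (integrableOn_const (by simp)) (hF.mono_set hsub)
            measurableSet_Ioc fun u hu => ?_
          have hu0 : 0 < u := hsub hu
          have e1 : Real.exp (-2) ≤ Real.exp (-u) := Real.exp_le_exp.2 (by linarith [hu.2])
          have e2 : (2 : ℝ) ^ (-|β|) ≤ u ^ β := hpow u (by linarith [hu.1]) hu.2
          have e3 : (2 : ℝ) ^ (-|β|) * ‖x‖ ^ (-β) ≤ (1 + u / (2 * ‖x‖)) ^ β := by
            have e4 : 1 + u / (2 * ‖x‖) = (‖x‖ + u / 2) * ‖x‖⁻¹ := by field_simp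
            rw [e4, Real.mul_rpow (by positivity) (by positivity), Real.inv_rpow hr.le,
              ← Real.rpow_neg hr.le]
            gcongr
            exact hpow _ (by linarith [hu.1]) (by linarith [hu.2])
          calc m * ‖x‖ ^ (-β) = Real.exp (-2) * 2 ^ (-|β|) * (2 ^ (-|β|) * ‖x‖ ^ (-β)) := by
                simp only [m]; ring
            _ ≤ _ := by gcongr
      _ ≤ _ := by
          refine setIntegral_mono_set hF ?_ hsub.eventuallyLE
          refine (ae_restrict_iff' measurableSet_Ioi).2 (ae_of_all _ fun u hu => ?_)
          have : (0 : ℝ) < u := hu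
          simp only [Pi.zero_apply]
          positivity
  have h3 : ‖x‖ ^ ((α - n) / 2 - 1 / 2) * ‖x‖ ^ (-β) = ‖x‖ ^ (α - n) := by
    rw [← Real.rpow_add hr]; congr 1; rw [hβ]; ring
  calc c * Real.exp (-1) * m * ‖x‖ ^ (α - n)
      = c * ‖x‖ ^ ((α - n) / 2 - 1 / 2) * Real.exp (-1) * (m * ‖x‖ ^ (-β)) := by rw [← h3]; ring
    _ ≤ _ := by gcongr

/-- Finiteness of all moments is what makes the potential of a bump a Schwartz function, hence a
candidate for the capacity. -/
lemma integrable_one_add_norm_pow_mul_besselKernel {n : ℕ} (hn : n ≠ 0) {α : ℝ} (hα0 : 0 < α)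
    (hα : α < n) (k : ℕ) :
    Integrable (fun x : EuclideanSpace ℝ (Fin n) => (1 + ‖x‖) ^ k * besselKernel n α x) := by
  have : Nonempty (Fin n) := Fin.pos_iff_nonempty.1 (Nat.pos_of_ne_zero hn)
  obtain ⟨C, hC, hCb⟩ := exists_besselKernel_le (n := n) hα
  obtain ⟨K, hK, hKb⟩ := exists_one_add_rpow_mul_exp_le (s := k) (ε := 1 / 4) (by positivity)
    (by norm_num)
  have hint : Integrable (fun x : EuclideanSpace ℝ (Fin n) =>
      ‖x‖ ^ (α - n) * Real.exp (-(1 / 4 * ‖x‖))) := by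
    rw [integrable_fun_norm_addHaar volume (f := fun r : ℝ => r ^ (α - n) * Real.exp (-(1 / 4 * r)))]
    have h1 := integrableOn_rpow_mul_exp_neg_mul_rpow (p := 1) (s := α - 1) (b := 1 / 4)
      (by linarith) one_pos (by norm_num)
    refine h1.congr_fun (fun r hr => ?_) measurableSet_Ioi
    have hr0 : (0 : ℝ) < r := hr
    simp only [Real.rpow_one, finrank_euclideanSpace, Fintype.card_fin, smul_eq_mul]
    rw [← mul_assoc, ← Real.rpow_natCast, ← Real.rpow_add hr0,
      Nat.cast_sub (Nat.one_le_iff_ne_zero.2 hn)]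
    congr 2
    · push_cast; ring
    · ring
  refine Integrable.mono' (hint.const_mul (C * K)) ?_ ?_
  · exact ((by fun_prop : Measurable fun x : EuclideanSpace ℝ (Fin n) => (1 + ‖x‖) ^ k).mul
      (measurable_besselKernel n α)).aestronglyMeasurable
  · have h0 : ∀ᵐ x : EuclideanSpace ℝ (Fin n), x ≠ 0 := by
      simp [ae_iff]
    filter_upwards [h0] with x hx
    rw [Real.norm_of_nonneg (mul_nonneg (by positivity) (besselKernel_nonneg hα x))]
    have h1 := hKb ‖x‖ (norm_nonneg x)
    rw [Real.rpow_natCast] at h1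
    have h2 : Real.exp (-(1 / 2 * ‖x‖)) = Real.exp (-(1 / 4 * ‖x‖)) * Real.exp (-(1 / 4 * ‖x‖)) := by
      rw [← Real.exp_add]; congr 1; ring
    calc (1 + ‖x‖) ^ k * besselKernel n α x
        ≤ (1 + ‖x‖) ^ k * (C * (‖x‖ ^ (α - n) * Real.exp (-(1 / 2 * ‖x‖)))) := by
          gcongr; exact hCb x hx
      _ = C * ((1 + ‖x‖) ^ k * Real.exp (-(1 / 4 * ‖x‖))) *
          (‖x‖ ^ (α - n) * Real.exp (-(1 / 4 * ‖x‖))) := by rw [h2]; ring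
      _ ≤ _ := by gcongr

lemma integrable_besselKernel {n : ℕ} (hn : n ≠ 0) {α : ℝ} (hα0 : 0 < α) (hα : α < n) :
    Integrable (besselKernel n α) := by
  simpa using integrable_one_add_norm_pow_mul_besselKernel hn hα0 hα 0

end BesselKernel

/-! ### Convolution with a test function is Schwartz -/

section ConvolutionDecay

open scoped Convolution ContDiff

/-- By ‖x‖ ≤ (1+‖t‖)(1+‖x-t‖) the polynomial weight is shared between the kernel, which has moments,
and the compactly supported g. -/
lemma exists_pow_mul_norm_convolution_le {E : Type} [NormedAddCommGroup E] [MeasurableSpace E]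
    {μ : Measure E} {E' F : Type} [NormedAddCommGroup E'] [NormedSpace ℝ E']
    [NormedAddCommGroup F] [NormedSpace ℝ F] (L : ℝ →L[ℝ] E' →L[ℝ] F) {f : E → ℝ} {g : E → E'}
    (k : ℕ) (hf : Integrable (fun x => (1 + ‖x‖) ^ k * f x) μ) (hg : Continuous g)
    (hgc : HasCompactSupport g) :
    ∃ C : ℝ, ∀ x, ‖x‖ ^ k * ‖(f ⋆[L, μ] g) x‖ ≤ C := by
  obtain ⟨D, hD⟩ : ∃ D, ∀ y, ‖(1 + ‖y‖) ^ k • g y‖ ≤ D := by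
    refine Continuous.bounded_above_of_compact_support (by fun_prop) (hgc.smul_left)
  have hD0 : 0 ≤ D := (norm_nonneg _).trans (hD 0)
  refine ⟨∫ t, ‖L‖ * D * ‖(1 + ‖t‖) ^ k * f t‖ ∂μ, fun x => ?_⟩
  rw [convolution_def, ← norm_norm x, ← norm_pow, ← norm_smul, ← integral_smul]
  refine norm_integral_le_of_norm_le (hf.norm.const_mul _) (ae_of_all _ fun t => ?_)
  have h1 : ‖x‖ ≤ (1 + ‖t‖) * (1 + ‖x - t‖) := by
    have := norm_add_le t (x - t)
    rw [add_sub_cancel] at this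
    nlinarith [norm_nonneg t, norm_nonneg (x - t)]
  have h2 := hD (x - t)
  rw [norm_smul, norm_pow, Real.norm_of_nonneg (by positivity)] at h2
  rw [norm_smul, norm_mul, norm_pow, norm_pow, norm_norm, Real.norm_of_nonneg
    (by positivity : (0 : ℝ) ≤ 1 + ‖t‖)]
  calc ‖x‖ ^ k * ‖L (f t) (g (x - t))‖
      ≤ ((1 + ‖t‖) * (1 + ‖x - t‖)) ^ k * (‖L‖ * ‖f t‖ * ‖g (x - t)‖) := by
        gcongr
        exact L.le_opNorm₂ _ _
    _ = ‖L‖ * ((1 + ‖x - t‖) ^ k * ‖g (x - t)‖) * ((1 + ‖t‖) ^ k * ‖f t‖) := by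
        rw [mul_pow]; ring
    _ ≤ _ := by gcongr

variable {E : Type} [NormedAddCommGroup E] [NormedSpace ℝ E] [FiniteDimensional ℝ E]
  [MeasurableSpace E] [BorelSpace E] {μ : Measure E} [μ.IsAddHaarMeasure]

/-- All derivatives fall on g. Each one changes the space of values of g, so the induction
quantifies over the spaces and the pairing L. -/
lemma exists_pow_mul_norm_iteratedFDeriv_convolution_le {f : E → ℝ}
    (hf : ∀ k : ℕ, Integrable (fun x => (1 + ‖x‖) ^ k * f x) μ) (k m : ℕ) :
    ∀ {E' F : Type} [NormedAddCommGroup E'] [NormedSpace ℝ E'] [NormedAddCommGroup F]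
      [NormedSpace ℝ F] (L : ℝ →L[ℝ] E' →L[ℝ] F) {g : E → E'}, ContDiff ℝ ∞ g →
      HasCompactSupport g → ∃ C : ℝ, ∀ x, ‖x‖ ^ k * ‖iteratedFDeriv ℝ m (f ⋆[L, μ] g) x‖ ≤ C := by
  induction m with
  | zero =>
    intro E' F _ _ _ _ L g hg hgc
    simpa using exists_pow_mul_norm_convolution_le L k (hf k) hg.continuous hgc
  | succ m ih =>
    intro E' F _ _ _ _ L g hg hgc
    have hloc : LocallyIntegrable f μ := by
      simpa using (hf 0).locallyIntegrable
    have hfd : fderiv ℝ (f ⋆[L, μ] g) = f ⋆[L.precompR E, μ] fderiv ℝ g := by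
      ext1 x
      exact (hgc.hasFDerivAt_convolution_right L hloc (hg.of_le (by simp)) x).fderiv
    obtain ⟨C, hC⟩ := ih (L.precompR E) (hg.fderiv_right (m := ∞) (by simp)) (hgc.fderiv (𝕜 := ℝ))
    refine ⟨C, fun x => ?_⟩
    rw [← norm_iteratedFDeriv_fderiv, hfd]
    exact hC x

/-- The convolution of a kernel, all of whose moments are finite, with a test function. -/
lemma exists_schwartzMap_convolution {f g : E → ℝ}
    (hf : ∀ k : ℕ, Integrable (fun x => (1 + ‖x‖) ^ k * f x) μ) (hg : ContDiff ℝ ∞ g)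
    (hgc : HasCompactSupport g) :
    ∃ F : 𝓢(E, ℝ), ∀ x, F x = ∫ y, f (x - y) * g y ∂μ := by
  have hloc : LocallyIntegrable f μ := by simpa using (hf 0).locallyIntegrable
  refine ⟨⟨f ⋆[ContinuousLinearMap.lsmul ℝ ℝ, μ] g, ?_, fun k m =>
    exists_pow_mul_norm_iteratedFDeriv_convolution_le hf k m _ hg hgc⟩, fun x => ?_⟩
  · exact hgc.contDiff_convolution_right _ hloc hg
  · change (f ⋆[ContinuousLinearMap.lsmul ℝ ℝ, μ] g) x = _
    rw [convolution_eq_swap]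
    rfl

end ConvolutionDecay

/-! ### Upper bound for the Bessel capacity of a ball -/

section BallCapacity

open scoped ContDiff

variable {n : ℕ} {α p : ℝ}

lemma exists_le_setIntegral_besselKernel (hn : n ≠ 0) (hα0 : 0 < α) (hα : α < n) :
    ∃ c : ℝ, 0 < c ∧ ∀ ρ : ℝ, 0 < ρ → ρ ≤ 1 →
      c * ρ ^ α ≤ ∫ t in Metric.ball (0 : EuclideanSpace ℝ (Fin n)) ρ, besselKernel n α t := by
  obtain ⟨c, hc, hcb⟩ := exists_le_besselKernel (n := n) hα
  set v := volume.real (Metric.ball (0 : EuclideanSpace ℝ (Fin n)) 1) with hv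
  have hv0 : 0 < v := ENNReal.toReal_pos (Metric.measure_ball_pos _ _ one_pos).ne'
    measure_ball_lt_top.ne
  refine ⟨c * v, by positivity, fun ρ hρ hρ1 => ?_⟩
  have hvol : volume.real (Metric.ball (0 : EuclideanSpace ℝ (Fin n)) ρ) = ρ ^ n * v := by
    rw [hv, measureReal_def, Measure.addHaar_ball_of_pos _ _ hρ, finrank_euclideanSpace,
      Fintype.card_fin, ENNReal.toReal_mul, ENNReal.toReal_ofReal (by positivity), measureReal_def]
  have h1 : ∫ t in Metric.ball (0 : EuclideanSpace ℝ (Fin n)) ρ, c * ρ ^ (α - n) = c * v * ρ ^ α := by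
    rw [setIntegral_const, hvol, smul_eq_mul, Real.rpow_sub hρ, Real.rpow_natCast]
    field_simp
  rw [← h1]
  refine setIntegral_mono_on_ae (integrableOn_const measure_ball_lt_top.ne)
    (integrable_besselKernel hn hα0 hα).integrableOn measurableSet_ball ?_
  have : Nonempty (Fin n) := Fin.pos_iff_nonempty.1 (Nat.pos_of_ne_zero hn)
  have h0 : ∀ᵐ x : EuclideanSpace ℝ (Fin n), x ≠ 0 := by simp [ae_iff]
  filter_upwards [h0] with t ht htρ
  have htρ' : ‖t‖ < ρ := by simpa using htρ
  refine le_trans ?_ (hcb t ht (htρ'.le.trans hρ1))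
  gcongr ?_ * ?_
  exact Real.rpow_le_rpow_of_nonpos (norm_pos_iff.2 ht) htρ'.le (by linarith)

lemma rpow_min_one_mul_eq_wAlpha {r : ℝ≥0} (hr : 0 < r) :
    ((min r 1 : ℝ≥0) : ℝ) ^ (-(α * p)) * (r : ℝ) ^ n = wAlpha n α p r := by
  have hr' : (0 : ℝ) < r := by exact_mod_cast hr
  rcases le_total r 1 with h | h
  · rw [min_eq_left h, wAlpha_of_le_one h, NNReal.coe_rpow, ← Real.rpow_natCast,
      ← Real.rpow_add hr']
    congr 1; ring
  · simp [min_eq_right h, wAlpha_of_le h]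

lemma exists_besselCapacity_ball_le (hn : n ≠ 0) (hα0 : 0 < α) (hα : α < n) (hp : 0 < p) :
    ∃ k : ℝ≥0, ∀ (x : EuclideanSpace ℝ (Fin n)) (r : ℝ≥0), 0 < r →
      besselCapacity n α p (Metric.ball x (r : ℝ)) ≤ k * wAlpha n α p r := by
  obtain ⟨c, hc, hcb⟩ := exists_le_setIntegral_besselKernel hn hα0 hα
  set v := volume.real (Metric.ball (0 : EuclideanSpace ℝ (Fin n)) 1) with hv
  have hv0 : 0 ≤ v := measureReal_nonneg
  refine ⟨(c⁻¹ ^ p * 3 ^ n * v).toNNReal, fun x r hr => ?_⟩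
  have hr' : (0 : ℝ) < r := by exact_mod_cast hr
  -- The lower bound c ρ^α for the mass of the kernel near 0 holds only up to radius 1. The factor A
  -- normalizes this mass to 1, and A^p |B(x,3r)| is a multiple of ρ^(-αp) rⁿ = w(r).
  set ρ : ℝ := ((min r 1 : ℝ≥0) : ℝ)
  have hρ : 0 < ρ := by exact_mod_cast lt_min hr one_pos
  have hρ1 : ρ ≤ 1 := by exact_mod_cast min_le_right r 1
  have hρr : ρ ≤ r := by exact_mod_cast min_le_left r 1
  set A : ℝ := (c * ρ ^ α)⁻¹ with hA
  have hA0 : 0 < A := by positivity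
  -- The bump is 1 on the ball of radius 2r, so it is 1 at y - t for y in B(x,r) and ‖t‖ < ρ ≤ r.
  let φ : ContDiffBump x := ⟨2 * r, 3 * r, by positivity, by linarith⟩
  obtain ⟨F, hF⟩ := exists_schwartzMap_convolution (f := besselKernel n α)
    (g := fun y => A * φ y) (μ := volume)
    (integrable_one_add_norm_pow_mul_besselKernel hn hα0 hα)
    (contDiff_const.mul φ.contDiff) φ.hasCompactSupport.mul_left
  have hG0 := besselKernel_nonneg (n := n) hα
  have hcont : Continuous fun y => A * φ y := continuous_const.mul φ.continuous
  have hF0 : ∀ y, 0 ≤ F y := fun y => by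
    rw [hF]
    exact integral_nonneg fun z => mul_nonneg (hG0 _) (mul_nonneg hA0.le φ.nonneg)
  have hF1 : ∀ y ∈ Metric.ball x (r : ℝ), 1 ≤ F y := fun y hy => by
    rw [hF, ← integral_sub_left_eq_self (fun z => besselKernel n α (y - z) * (A * φ z)) volume y]
    simp only [sub_sub_cancel]
    have hint : Integrable fun z => besselKernel n α z * (A * φ (y - z)) := by
      refine (integrable_besselKernel hn hα0 hα).mul_bdd (c := A)
        (hcont.comp (by fun_prop : Continuous fun z => y - z)).aestronglyMeasurable
        (ae_of_all _ fun z => ?_)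
      rw [Real.norm_of_nonneg (mul_nonneg hA0.le φ.nonneg)]
      exact mul_le_of_le_one_right hA0.le φ.le_one
    calc (1 : ℝ) = A * (c * ρ ^ α) := (inv_mul_cancel₀ (by positivity)).symm
      _ ≤ A * ∫ t in Metric.ball (0 : EuclideanSpace ℝ (Fin n)) ρ, besselKernel n α t := by
          gcongr; exact hcb ρ hρ hρ1
      _ = ∫ t in Metric.ball (0 : EuclideanSpace ℝ (Fin n)) ρ,
            besselKernel n α t * (A * φ (y - t)) := by
          rw [← integral_const_mul]
          refine setIntegral_congr_fun measurableSet_ball fun t ht => ?_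
          have ht' : ‖t‖ < ρ := by simpa using ht
          have : φ (y - t) = 1 := φ.one_of_mem_closedBall (by
            rw [Metric.mem_closedBall, dist_eq_norm]
            have h1 := norm_sub_le (y - x) t
            rw [Metric.mem_ball, dist_eq_norm] at hy
            rw [show y - t - x = y - x - t by abel]
            show _ ≤ 2 * (r : ℝ)
            linarith)
          simp only [this]; ring
      _ ≤ _ := setIntegral_le_integral hint
          (ae_of_all _ fun z => mul_nonneg (hG0 _) (mul_nonneg hA0.le φ.nonneg))
  have hpT : ENNReal.ofReal p ≠ ⊤ := ENNReal.ofReal_ne_top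
  have hp0 : ENNReal.ofReal p ≠ 0 := by simpa using hp
  have hmem : MemLp (fun y => A * φ y) (ENNReal.ofReal p) volume :=
    hcont.memLp_of_hasCompactSupport φ.hasCompactSupport.mul_left
  refine (iInf₂_le F hF0).trans ((iInf_le _ hF1).trans ?_)
  have hnorm : besselNorm n α p F ≤ eLpNorm (fun y => A * φ y) (ENNReal.ofReal p) volume :=
    (iInf₂_le (fun y => A * φ y) hmem).trans (iInf_le _ (ae_of_all _ hF))
  have hle : eLpNorm (fun y => A * φ y) (ENNReal.ofReal p) volume
      ≤ ENNReal.ofReal A * volume (Metric.ball x (3 * r)) ^ (1 / p) := by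
    calc _ ≤ eLpNorm ((Metric.ball x (3 * r : ℝ)).indicator fun _ => A)
          (ENNReal.ofReal p) volume := by
          refine eLpNorm_mono fun y => ?_
          rw [Real.norm_of_nonneg (mul_nonneg hA0.le φ.nonneg)]
          by_cases hy : y ∈ Metric.ball x (3 * r : ℝ)
          · rw [indicator_of_mem hy, Real.norm_of_nonneg hA0.le]
            exact mul_le_of_le_one_right hA0.le φ.le_one
          · have : φ y = 0 := φ.zero_of_le_dist (by simpa using hy)
            simp [this]
      _ = _ := by
          rw [eLpNorm_indicator_const measurableSet_ball hp0 hpT, ENNReal.toReal_ofReal hp.le,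
            Real.enorm_eq_ofReal hA0.le]
  calc besselNorm n α p F ^ p
      ≤ (ENNReal.ofReal A * volume (Metric.ball x (3 * r)) ^ (1 / p)) ^ p := by
        gcongr; exact hnorm.trans hle
    _ = ENNReal.ofReal (A ^ p) * volume (Metric.ball x (3 * r)) := by
        rw [ENNReal.mul_rpow_of_nonneg _ _ hp.le, ← ENNReal.rpow_mul, one_div_mul_cancel hp.ne',
          ENNReal.rpow_one, ENNReal.ofReal_rpow_of_nonneg hA0.le hp.le]
    _ = ENNReal.ofReal (A ^ p * ((3 * r) ^ n * v)) := by
        rw [Measure.addHaar_ball_of_pos _ _ (by positivity), finrank_euclideanSpace,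
          Fintype.card_fin, ENNReal.ofReal_mul (by positivity), ENNReal.ofReal_mul (by positivity),
          hv, ofReal_measureReal measure_ball_lt_top.ne]
    _ = ENNReal.ofReal (c⁻¹ ^ p * 3 ^ n * v * wAlpha n α p r) := by
        rw [← rpow_min_one_mul_eq_wAlpha hr, hA, mul_inv, Real.mul_rpow (by positivity)
          (by positivity), ← Real.rpow_neg hρ.le, ← Real.rpow_mul hρ.le, neg_mul]
        congr 1; ring
    _ = _ := by
        rw [ENNReal.ofReal_mul (by positivity), ENNReal.ofReal_coe_nnreal]
        rfl

end BallCapacity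

/-! ### Radial majorant and averages of the kernel -/

section KernelAverage

/-- The radial majorant `min (r ^ (α - n)) (r ^ (-n))` of the Bessel kernel. -/
noncomputable def kernelMajorant (n : ℕ) (α r : ℝ) : ℝ := min (r ^ (α - n)) (r ^ (-(n : ℝ)))

variable {n : ℕ} {α : ℝ}

@[fun_prop]
lemma measurable_kernelMajorant : Measurable (kernelMajorant n α) := by
  unfold kernelMajorant; fun_prop

lemma kernelMajorant_pos {r : ℝ} (hr : 0 < r) : 0 < kernelMajorant n α r :=
  lt_min (Real.rpow_pos_of_pos hr _) (Real.rpow_pos_of_pos hr _)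

lemma kernelMajorant_anti (hα : α ≤ n) {r s : ℝ} (hr : 0 < r) (hrs : r ≤ s) :
    kernelMajorant n α s ≤ kernelMajorant n α r :=
  min_le_min (Real.rpow_le_rpow_of_nonpos hr hrs (by linarith))
    (Real.rpow_le_rpow_of_nonpos hr hrs (by simp))

lemma kernelMajorant_le_mul (hα0 : 0 ≤ α) {k r : ℝ} (hk : 1 ≤ k) (hr : 0 < r) :
    kernelMajorant n α r ≤ k ^ n * kernelMajorant n α (k * r) := by
  have hk0 : 0 < k := by linarith
  unfold kernelMajorant
  rw [mul_min_of_nonneg _ _ (by positivity), Real.mul_rpow hk0.le hr.le,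
    Real.mul_rpow hk0.le hr.le, ← mul_assoc, ← mul_assoc, ← Real.rpow_natCast,
    ← Real.rpow_add hk0, ← Real.rpow_add hk0]
  refine min_le_min (le_mul_of_one_le_left (by positivity) (Real.one_le_rpow hk (by linarith))) ?_
  simp

lemma pow_mul_kernelMajorant {r : ℝ} (hr : 0 < r) :
    r ^ n * kernelMajorant n α r = min (r ^ α) 1 := by
  unfold kernelMajorant
  rw [mul_min_of_nonneg _ _ (by positivity), ← Real.rpow_natCast, ← Real.rpow_add hr,
    ← Real.rpow_add hr]
  simp

lemma exists_besselKernel_le_kernelMajorant (hα0 : 0 ≤ α) (hα : α < n) :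
    ∃ C : ℝ, 0 < C ∧ ∀ x : EuclideanSpace ℝ (Fin n), x ≠ 0 →
      besselKernel n α x ≤ C * kernelMajorant n α ‖x‖ := by
  obtain ⟨C, hC, hCb⟩ := exists_besselKernel_le (n := n) hα
  obtain ⟨K, hK, hKb⟩ := exists_one_add_rpow_mul_exp_le hα0 (one_half_pos (α := ℝ))
  refine ⟨C * max 1 K, by positivity, fun x hx => (hCb x hx).trans ?_⟩
  have hr : 0 < ‖x‖ := norm_pos_iff.2 hx
  rw [mul_assoc]
  refine mul_le_mul_of_nonneg_left ?_ hC.le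
  unfold kernelMajorant
  rw [mul_min_of_nonneg _ _ (by positivity)]
  refine le_min ?_ ?_
  · rw [mul_comm]
    gcongr
    exact (Real.exp_le_one_iff.2 (by linarith)).trans (le_max_left _ _)
  · have h1 : ‖x‖ ^ (α - n) = ‖x‖ ^ α * ‖x‖ ^ (-(n : ℝ)) := by
      rw [← Real.rpow_add hr, sub_eq_add_neg]
    rw [h1, mul_right_comm]
    gcongr
    refine le_trans ?_ ((hKb ‖x‖ hr.le).trans (le_max_right _ _))
    gcongr
    linarith

lemma setIntegral_ball_norm_rpow (hn : n ≠ 0) (hα0 : 0 < α) {R : ℝ} (hR : 0 < R) :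
    IntegrableOn (fun x : EuclideanSpace ℝ (Fin n) => ‖x‖ ^ (α - n)) (Metric.ball 0 R) ∧
    ∫ x in Metric.ball (0 : EuclideanSpace ℝ (Fin n)) R, ‖x‖ ^ (α - n) =
      n * volume.real (Metric.ball (0 : EuclideanSpace ℝ (Fin n)) 1) / α * R ^ α := by
  have : Nonempty (Fin n) := Fin.pos_iff_nonempty.1 (Nat.pos_of_ne_zero hn)
  have hmul : ∀ y : ℝ, 0 < y → y ^ (n - 1) * y ^ (α - n) = y ^ (α - 1) := fun y hy => by
    rw [← Real.rpow_natCast, ← Real.rpow_add hy, Nat.cast_sub (Nat.one_le_iff_ne_zero.2 hn)]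
    congr 1; push_cast; ring
  constructor
  · rw [integrableOn_fun_norm_addHaar volume (f := fun r : ℝ => r ^ (α - n)),
      finrank_euclideanSpace, Fintype.card_fin]
    have h1 := (intervalIntegral.integrableOn_Ioo_rpow_iff (s := α - 1) hR).2 (by linarith)
    exact h1.congr_fun (fun y hy => (hmul y hy.1).symm) measurableSet_Ioo
  · have h1 := integral_fun_norm_addHaar (volume : Measure (EuclideanSpace ℝ (Fin n)))
      ((Iio R).indicator fun r : ℝ => r ^ (α - n))
    have h2 : (fun x : EuclideanSpace ℝ (Fin n) => (Iio R).indicator (fun r : ℝ => r ^ (α - n)) ‖x‖)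
        = (Metric.ball 0 R).indicator fun x => ‖x‖ ^ (α - n) := by
      ext x; simp [indicator]
    have h3 : ∫ y in Ioi (0 : ℝ), y ^ (n - 1) • (Iio R).indicator (fun r : ℝ => r ^ (α - n)) y
        = R ^ α / α := by
      have h4 : ∫ y in Ioi (0 : ℝ), y ^ (n - 1) • (Iio R).indicator (fun r : ℝ => r ^ (α - n)) y
          = ∫ y in Ioi (0 : ℝ), (Iio R).indicator (fun r : ℝ => r ^ (α - 1)) y := by
        refine setIntegral_congr_fun measurableSet_Ioi fun y hy => ?_
        by_cases h : y < R
        · simp [h, hmul y hy]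
        · simp [h]
      rw [h4, setIntegral_indicator measurableSet_Iio, Ioi_inter_Iio,
        ← integral_Ioc_eq_integral_Ioo, ← intervalIntegral.integral_of_le hR.le,
        integral_rpow (Or.inl (by linarith)), sub_add_cancel, Real.zero_rpow hα0.ne', sub_zero]
    rw [h2, integral_indicator measurableSet_ball, finrank_euclideanSpace, Fintype.card_fin, h3] at h1
    rw [h1, nsmul_eq_mul, smul_eq_mul]
    ring

lemma exists_setLIntegral_ball_besselKernel_le (hn : n ≠ 0) (hα0 : 0 < α) (hα : α < n) :
    ∃ C : ℝ, 0 < C ∧ ∀ R : ℝ, 0 < R →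
      ∫⁻ z in Metric.ball (0 : EuclideanSpace ℝ (Fin n)) R, ENNReal.ofReal (besselKernel n α z)
        ≤ ENNReal.ofReal (C * min (R ^ α) 1) := by
  have : Nonempty (Fin n) := Fin.pos_iff_nonempty.1 (Nat.pos_of_ne_zero hn)
  have h0 : ∀ᵐ x : EuclideanSpace ℝ (Fin n), x ≠ 0 := by simp [ae_iff]
  obtain ⟨C, hC, hCb⟩ := exists_besselKernel_le_kernelMajorant (n := n) hα0.le hα
  have hG0 := besselKernel_nonneg (n := n) hα
  have hG := integrable_besselKernel hn hα0 hα
  set D := C * (n * volume.real (Metric.ball (0 : EuclideanSpace ℝ (Fin n)) 1) / α) with hD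
  have hD0 : 0 ≤ D := by positivity
  set I := ∫ z, besselKernel n α z with hI
  have hI0 : 0 ≤ I := integral_nonneg hG0
  refine ⟨D + I + 1, by positivity, fun R hR => ?_⟩
  rw [← ofReal_integral_eq_lintegral_ofReal hG.integrableOn (ae_of_all _ hG0)]
  refine ENNReal.ofReal_le_ofReal ?_
  rw [mul_min_of_nonneg _ _ (by positivity)]
  obtain ⟨hi, he⟩ := setIntegral_ball_norm_rpow (α := α) hn hα0 hR
  refine le_min ?_ ?_
  · calc _ ≤ ∫ z in Metric.ball (0 : EuclideanSpace ℝ (Fin n)) R, C * ‖z‖ ^ (α - n) := by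
          refine integral_mono_ae hG.integrableOn (hi.const_mul C) (ae_restrict_of_ae ?_)
          filter_upwards [h0] with z hz
          refine (hCb z hz).trans ?_
          gcongr
          exact min_le_left _ _
      _ = D * R ^ α := by rw [integral_const_mul, he, hD]; ring
      _ ≤ _ := by gcongr; linarith
  · rw [mul_one]
    exact (setIntegral_le_integral hG (ae_of_all _ hG0)).trans (by linarith)

/-- The mean value of the Bessel kernel over a ball of radius `t` at distance `d` from the pole is
at most a multiple of the majorant at `max t d`. -/
lemma exists_setLIntegral_besselKernel_sub_le (hn : n ≠ 0) (hα0 : 0 < α) (hα : α < n) :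
    ∃ C : ℝ≥0, ∀ (x y : EuclideanSpace ℝ (Fin n)) (t : ℝ), 0 < t →
      ∫⁻ z in Metric.ball x t, ENNReal.ofReal (besselKernel n α (z - y)) ≤
        C * ENNReal.ofReal (kernelMajorant n α (max t (dist x y))) * volume (Metric.ball x t) := by
  obtain ⟨C₁, hC₁, hC₁b⟩ := exists_besselKernel_le_kernelMajorant (n := n) hα0.le hα
  obtain ⟨C₂, hC₂, hC₂b⟩ := exists_setLIntegral_ball_besselKernel_le hn hα0 hα
  set v := volume.real (Metric.ball (0 : EuclideanSpace ℝ (Fin n)) 1) with hv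
  have hv0 : 0 < v := ENNReal.toReal_pos (Metric.measure_ball_pos _ _ one_pos).ne'
    measure_ball_lt_top.ne
  refine ⟨(max (C₁ * 2 ^ n) (C₂ * 3 ^ n / v)).toNNReal, fun x y t ht => ?_⟩
  have hm : 0 < max t (dist x y) := lt_max_of_lt_left ht
  have hvol : volume (Metric.ball x t) = ENNReal.ofReal (t ^ n * v) := by
    rw [Measure.addHaar_ball_of_pos _ _ ht, finrank_euclideanSpace, Fintype.card_fin,
      ENNReal.ofReal_mul (by positivity), hv, ofReal_measureReal measure_ball_lt_top.ne]
  set m := max t (dist x y)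
  have hτ := kernelMajorant_pos (n := n) (α := α) hm
  change _ ≤ ENNReal.ofReal _ * _ * _
  -- Far from the pole the kernel is controlled pointwise on the ball, where ‖z - y‖ ≥ m/2. Near it,
  -- the translated ball lies in B(0,3t), and the total mass there is at most a multiple of
  -- min((3t)^α, 1) = (3t)ⁿ τ(3t), with m ≤ 3t.
  rcases le_or_gt (2 * t) (dist x y) with hd | hd
  · have hmd : m = dist x y := max_eq_right (by linarith)
    have h1 : ∀ z ∈ Metric.ball x t, ENNReal.ofReal (besselKernel n α (z - y)) ≤
        ENNReal.ofReal (C₁ * 2 ^ n * kernelMajorant n α m) := by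
      intro z hz
      refine ENNReal.ofReal_le_ofReal ?_
      have hz' : m / 2 ≤ ‖z - y‖ := by
        rw [← dist_eq_norm, hmd]
        have := dist_triangle x z y
        rw [Metric.mem_ball, dist_comm] at hz
        linarith
      have hz0 : 0 < ‖z - y‖ := lt_of_lt_of_le (by positivity) hz'
      refine (hC₁b _ (norm_pos_iff.1 hz0)).trans ?_
      rw [mul_assoc]
      gcongr
      refine (kernelMajorant_anti hα.le (by positivity) hz').trans ?_
      have := kernelMajorant_le_mul (n := n) hα0.le one_le_two (half_pos hm)
      rwa [mul_div_cancel₀ m two_ne_zero] at this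
    refine (setLIntegral_mono' measurableSet_ball h1).trans ?_
    rw [setLIntegral_const, ENNReal.ofReal_mul (by positivity)]
    gcongr
    exact le_max_left _ _
  · have hm3 : m ≤ 3 * t := max_le (by linarith) (by linarith)
    have h1 : ∫⁻ z in Metric.ball x t, ENNReal.ofReal (besselKernel n α (z - y)) ≤
        ∫⁻ z in Metric.ball (0 : EuclideanSpace ℝ (Fin n)) (3 * t),
          ENNReal.ofReal (besselKernel n α z) := by
      rw [← lintegral_indicator measurableSet_ball, ← lintegral_indicator measurableSet_ball,
        ← lintegral_sub_right_eq_self (fun z => (Metric.ball (0 : EuclideanSpace ℝ (Fin n))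
          (3 * t)).indicator (fun z => ENNReal.ofReal (besselKernel n α z)) z) y]
      refine lintegral_mono fun z => ?_
      by_cases hz : z ∈ Metric.ball x t
      · have hz' : z - y ∈ Metric.ball (0 : EuclideanSpace ℝ (Fin n)) (3 * t) := by
          rw [mem_ball_zero_iff, ← dist_eq_norm]
          have := dist_triangle z x y
          rw [Metric.mem_ball] at hz
          linarith
        rw [indicator_of_mem hz, indicator_of_mem hz']
      · rw [indicator_of_notMem hz]; exact zero_le (a := _)
    refine h1.trans ((hC₂b _ (by positivity)).trans ?_)
    rw [hvol, ← ENNReal.ofReal_mul (by positivity), ← ENNReal.ofReal_mul (by positivity)]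
    refine ENNReal.ofReal_le_ofReal ?_
    rw [← pow_mul_kernelMajorant (n := n) (by positivity : 0 < 3 * t)]
    calc C₂ * ((3 * t) ^ n * kernelMajorant n α (3 * t))
        ≤ C₂ * ((3 * t) ^ n * kernelMajorant n α m) := by
          gcongr
          exact kernelMajorant_anti hα.le hm hm3
      _ = C₂ * 3 ^ n / v * kernelMajorant n α m * (t ^ n * v) := by
          rw [mul_pow]; field_simp
      _ ≤ _ := by
          gcongr
          exact le_max_right _ _

/-- The interval (m, 2m) is enough, since the majorant decreases and is doubling. This stands in for
a layer-cake formula and needs no derivative of the majorant. -/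
lemma kernelMajorant_le_setLIntegral (hα0 : 0 ≤ α) (hα : α ≤ n) {m : ℝ} (hm : 0 < m) :
    ENNReal.ofReal (kernelMajorant n α m) ≤
      2 ^ (n + 1) * ∫⁻ r in Ioi m, ENNReal.ofReal (kernelMajorant n α r / r) := by
  have h1 : ENNReal.ofReal (kernelMajorant n α (2 * m) / (2 * m)) * ENNReal.ofReal (2 * m - m) ≤
      ∫⁻ r in Ioi m, ENNReal.ofReal (kernelMajorant n α r / r) := by
    rw [← Real.volume_Ioo, ← setLIntegral_const]
    refine (setLIntegral_mono' measurableSet_Ioo fun r hr => ?_).trans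
      (lintegral_mono_set Ioo_subset_Ioi_self)
    have hr0 : 0 < r := hm.trans hr.1
    have := kernelMajorant_anti hα hr0 hr.2.le
    have := (kernelMajorant_pos (n := n) (α := α) hr0).le
    have := hr.2.le
    gcongr
  calc ENNReal.ofReal (kernelMajorant n α m)
      ≤ ENNReal.ofReal (2 ^ n * kernelMajorant n α (2 * m)) :=
        ENNReal.ofReal_le_ofReal (kernelMajorant_le_mul hα0 one_le_two hm)
    _ = 2 ^ (n + 1) *
        (ENNReal.ofReal (kernelMajorant n α (2 * m) / (2 * m)) * ENNReal.ofReal (2 * m - m)) := by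
        have hpos := (kernelMajorant_pos (n := n) (α := α) (by positivity : 0 < 2 * m)).le
        rw [show (2 : ℝ≥0∞) ^ (n + 1) = ENNReal.ofReal (2 ^ (n + 1)) by
            rw [ENNReal.ofReal_pow two_pos.le]; simp,
          ← ENNReal.ofReal_mul (by positivity), ← ENNReal.ofReal_mul (by positivity)]
        congr 1
        field_simp
        ring
    _ ≤ _ := by gcongr

end KernelAverage

/-! ### Truncated Dini integrals -/

section TruncatedDini

variable {Φ : ℝ≥0 → ℝ≥0} {p : ℝ}

lemma lintegral_Ioi_comp_rpow_div (K : ℝ → ℝ≥0∞) {a : ℝ} (ha : 0 < a) :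
    ∫⁻ r in Ioi (0 : ℝ), ENNReal.ofReal r⁻¹ * K (r ^ a) =
      ENNReal.ofReal a⁻¹ * ∫⁻ u in Ioi (0 : ℝ), ENNReal.ofReal u⁻¹ * K u := by
  have himg : (fun r : ℝ => r ^ a) '' Ioi 0 = Ioi 0 := by
    ext u
    constructor
    · rintro ⟨r, hr, rfl⟩
      exact Real.rpow_pos_of_pos hr a
    · intro hu
      exact ⟨u ^ a⁻¹, Real.rpow_pos_of_pos hu _, Real.rpow_inv_rpow (le_of_lt hu) ha.ne'⟩
  have h := lintegral_image_eq_lintegral_abs_deriv_mul (f := fun r : ℝ => r ^ a)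
    (f' := fun r => a * r ^ (a - 1)) measurableSet_Ioi
    (fun r hr => (Real.hasDerivAt_rpow_const (Or.inl (ne_of_gt hr))).hasDerivWithinAt)
    (fun r hr s hs h => (Real.rpow_left_inj (le_of_lt hr) (le_of_lt hs) ha.ne').1 h)
    fun u => ENNReal.ofReal u⁻¹ * K u
  rw [himg] at h
  rw [h, ← lintegral_const_mul' _ _ ENNReal.ofReal_ne_top]
  refine setLIntegral_congr_fun measurableSet_Ioi fun r hr => ?_
  have hr0 : (0 : ℝ) < r := hr
  rw [← mul_assoc, ← mul_assoc, ← ENNReal.ofReal_mul (by positivity),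
    ← ENNReal.ofReal_mul (by positivity), abs_of_nonneg (by positivity)]
  congr 2
  rw [Real.rpow_sub_one hr0.ne']
  have := (Real.rpow_pos_of_pos hr0 a).ne'
  field_simp

/-- The Dini condition, truncated at height `M ≈ Φ(s)` and continued to infinity. -/
lemma DiniCondition.exists_lintegral_min_le (hp : 0 < p) (h : DiniCondition p Φ) (c : ℝ≥0) :
    ∃ C : ℝ≥0, ∀ s M : ℝ≥0, 0 < s → Φ s ≤ c * M →
      ∫⁻ u in Ioi (0 : ℝ), ENNReal.ofReal u⁻¹ *
        ENNReal.ofReal (((min M (Φ u.toNNReal) : ℝ≥0) / u : ℝ) ^ (1 / p)) ≤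
      C * ENNReal.ofReal ((M / s : ℝ) ^ (1 / p)) := by
  obtain ⟨C, hC⟩ := h
  refine ⟨C * c ^ (1 / p) + p.toNNReal, fun s M hs hM => ?_⟩
  have hs' : (0 : ℝ) < s := by exact_mod_cast hs
  have hcr : ENNReal.ofReal ((c : ℝ) ^ (1 / p)) = ((c ^ (1 / p) : ℝ≥0) : ℝ≥0∞) := by
    rw [← NNReal.coe_rpow, ENNReal.ofReal_coe_nnreal]
  -- Below s the Dini condition applies, with Φ(s) ≤ cM. Above s the truncation at M leaves ∫
  -- M^(1/p) u^(-1/p-1) du = p (M/s)^(1/p).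
  rw [← Ioo_union_Ici_eq_Ioi hs']
  refine (lintegral_union_le _ _ _).trans ?_
  rw [ENNReal.coe_add, add_mul]
  refine add_le_add ?_ ?_
  · calc _ ≤ ∫⁻ u in Ioo (0 : ℝ) s, ENNReal.ofReal (((Φ u.toNNReal : ℝ) / u) ^ (1 / p) / u) := by
          refine setLIntegral_mono' measurableSet_Ioo fun u hu => ?_
          have hu0 := hu.1
          rw [← ENNReal.ofReal_mul (by positivity), inv_mul_eq_div]
          refine ENNReal.ofReal_le_ofReal ?_
          have : ((min M (Φ u.toNNReal) : ℝ≥0) : ℝ) ≤ Φ u.toNNReal := by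
            exact_mod_cast min_le_right _ _
          gcongr
      _ ≤ C * ENNReal.ofReal (((Φ s : ℝ) / s) ^ (1 / p)) := hC s hs
      _ ≤ C * (ENNReal.ofReal ((c : ℝ) ^ (1 / p)) * ENNReal.ofReal ((M / s : ℝ) ^ (1 / p))) := by
          gcongr
          rw [← ENNReal.ofReal_mul (by positivity)]
          exact ENNReal.ofReal_le_ofReal (div_rpow_le_mul_div_rpow hp (by positivity)
            (by positivity) (by positivity) hs' (by exact_mod_cast hM))
      _ = _ := by rw [hcr]; push_cast; ring
  · have hexp : -(1 / p) - 1 < -1 := by have := one_div_pos.2 hp; linarith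
    calc _ ≤ ∫⁻ u in Ioi (s : ℝ), ENNReal.ofReal ((M : ℝ) ^ (1 / p) * u ^ (-(1 / p) - 1)) := by
          rw [setLIntegral_congr (Ioi_ae_eq_Ici (a := (s : ℝ))).symm]
          refine setLIntegral_mono' measurableSet_Ioi fun u hu => ?_
          have hu0 : 0 < u := hs'.trans hu
          rw [← ENNReal.ofReal_mul (by positivity)]
          refine ENNReal.ofReal_le_ofReal ?_
          have h1 : ((min M (Φ u.toNNReal) : ℝ≥0) : ℝ) ≤ M := by exact_mod_cast min_le_left _ _
          calc u⁻¹ * (((min M (Φ u.toNNReal) : ℝ≥0) / u : ℝ) ^ (1 / p))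
              ≤ u⁻¹ * ((M / u : ℝ) ^ (1 / p)) := by gcongr
            _ = _ := by
              rw [Real.div_rpow M.coe_nonneg hu0.le, Real.rpow_sub_one hu0.ne', Real.rpow_neg hu0.le]
              field_simp
      _ = ENNReal.ofReal ((M : ℝ) ^ (1 / p) * (p * (s : ℝ) ^ (-(1 / p)))) := by
          have hi := (integrableOn_Ioi_rpow_of_lt hexp hs').const_mul ((M : ℝ) ^ (1 / p))
          rw [← ofReal_integral_eq_lintegral_ofReal hi, integral_const_mul,
            integral_Ioi_rpow_of_lt hexp hs']
          · congr 2
            rw [sub_add_cancel]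
            field_simp
          · refine (ae_restrict_iff' measurableSet_Ioi).2 (ae_of_all _ fun u hu => ?_)
            have hu0 : 0 < u := hs'.trans hu
            simp only [Pi.zero_apply]
            positivity
      _ = _ := by
          rw [← ENNReal.ofReal_coe_nnreal (p := p.toNNReal), Real.coe_toNNReal _ hp.le,
            ← ENNReal.ofReal_mul hp.le, Real.div_rpow M.coe_nonneg s.coe_nonneg, Real.rpow_neg s.coe_nonneg]
          congr 1
          ring

/-- The measure dr/r changes only by a constant factor under u = r^a; this is used with a = n - αp
on (0, 1) and a = n on [1, ∞). -/
lemma exists_lintegral_min_wAlpha_le {n : ℕ} {α : ℝ} (hn : n ≠ 0) (hpn : α * p < n) (hp : 0 < p)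
    (h : DiniCondition p Φ) (c : ℝ≥0) :
    ∃ C : ℝ≥0, ∀ s M : ℝ≥0, 0 < s → Φ s ≤ c * M →
      ∫⁻ r in Ioi (0 : ℝ), ENNReal.ofReal r⁻¹ *
        ENNReal.ofReal (((min M (Φ (wAlpha n α p r.toNNReal)) : ℝ≥0) /
          wAlpha n α p r.toNNReal : ℝ) ^ (1 / p)) ≤
      C * ENNReal.ofReal ((M / s : ℝ) ^ (1 / p)) := by
  obtain ⟨C, hC⟩ := h.exists_lintegral_min_le hp c
  have hn' : (0 : ℝ) < n := by exact_mod_cast Nat.pos_of_ne_zero hn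
  have ha : 0 < n - α * p := by linarith
  refine ⟨((n - α * p)⁻¹.toNNReal + (n : ℝ)⁻¹.toNNReal) * C, fun s M hs hM => ?_⟩
  set K : ℝ → ℝ≥0∞ := fun u => ENNReal.ofReal (((min M (Φ u.toNNReal) : ℝ≥0) / u : ℝ) ^ (1 / p))
  have hbd := hC s M hs hM
  have hK : ∀ r ∈ Ioi (0 : ℝ), ENNReal.ofReal (((min M (Φ (wAlpha n α p r.toNNReal)) : ℝ≥0) /
      wAlpha n α p r.toNNReal : ℝ) ^ (1 / p)) = K (wAlpha n α p r.toNNReal) := by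
    intro r hr
    simp only [K, Real.toNNReal_coe]
  rw [setLIntegral_congr_fun measurableSet_Ioi (fun r hr => by rw [hK r hr]),
    ← Ioo_union_Ici_eq_Ioi one_pos]
  refine (lintegral_union_le _ _ _).trans ?_
  rw [ENNReal.coe_mul, ENNReal.coe_add, mul_assoc, add_mul]
  refine add_le_add ?_ ?_
  · calc _ = ∫⁻ r in Ioo (0 : ℝ) 1, ENNReal.ofReal r⁻¹ * K (r ^ ((n : ℝ) - α * p)) := by
          refine setLIntegral_congr_fun measurableSet_Ioo fun r hr => ?_
          have h1 : r.toNNReal ≤ 1 := Real.toNNReal_le_one.2 hr.2.le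
          rw [wAlpha_of_le_one h1, NNReal.coe_rpow, Real.coe_toNNReal _ hr.1.le]
      _ ≤ _ := lintegral_mono_set Ioo_subset_Ioi_self
      _ = _ := lintegral_Ioi_comp_rpow_div K ha
      _ ≤ _ := by
          gcongr
          rfl
  · calc _ = ∫⁻ r in Ici (1 : ℝ), ENNReal.ofReal r⁻¹ * K (r ^ (n : ℝ)) := by
          refine setLIntegral_congr_fun measurableSet_Ici fun r hr => ?_
          have h1 : 1 ≤ r.toNNReal := by
            rw [← Real.toNNReal_one]; exact Real.toNNReal_le_toNNReal hr
          rw [wAlpha_of_le h1, NNReal.coe_pow, Real.coe_toNNReal _ (zero_le_one.trans hr),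
            Real.rpow_natCast]
      _ ≤ _ := lintegral_mono_set (Ici_subset_Ioi.2 one_pos)
      _ = _ := lintegral_Ioi_comp_rpow_div K hn'
      _ ≤ _ := by
          gcongr
          rfl

end TruncatedDini

/-! ### Averaging over tents, Hölder and cylinders -/

section CapacitaryEstimate

variable {n : ℕ} {α p : ℝ}

/-- The ball B(x,t) of a tent point lies in O, so the lower bound 1 may be averaged over it; Tonelli
then puts the average on the kernel. -/
lemma exists_one_le_lintegral_kernelMajorant (hn : n ≠ 0) (hα0 : 0 < α) (hα : α < n) :
    ∃ C : ℝ≥0, ∀ (O : Set (EuclideanSpace ℝ (Fin n))) (h : EuclideanSpace ℝ (Fin n) → ℝ≥0∞),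
      Measurable h →
      (∀ᵐ z, z ∈ O → 1 ≤ ∫⁻ y, ENNReal.ofReal (besselKernel n α (z - y)) * h y) →
      ∀ q ∈ tent O,
        1 ≤ C * ∫⁻ y, ENNReal.ofReal (kernelMajorant n α (max (q.2 : ℝ) (dist q.1 y))) * h y := by
  obtain ⟨C, hC⟩ := exists_setLIntegral_besselKernel_sub_le hn hα0 hα
  refine ⟨C, fun O h hh hO q hq => ?_⟩
  have ht : (0 : ℝ) < q.2 := q.2.2
  have hV0 : volume (Metric.ball q.1 (q.2 : ℝ)) ≠ 0 := (Metric.measure_ball_pos _ _ ht).ne'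
  have hVt : volume (Metric.ball q.1 (q.2 : ℝ)) ≠ ∞ := measure_ball_lt_top.ne
  have hG := measurable_besselKernel n α
  refine (ENNReal.mul_le_mul_iff_left hV0 hVt).1 ?_
  calc 1 * volume (Metric.ball q.1 (q.2 : ℝ)) = ∫⁻ z in Metric.ball q.1 (q.2 : ℝ), 1 := by
        rw [setLIntegral_const]
    _ ≤ ∫⁻ z in Metric.ball q.1 (q.2 : ℝ),
          ∫⁻ y, ENNReal.ofReal (besselKernel n α (z - y)) * h y := by
        refine setLIntegral_mono_ae' measurableSet_ball ?_
        filter_upwards [hO] with z hz hzB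
        exact hz (ball_subset_of_mem_tent hq hzB)
    _ = ∫⁻ y, ∫⁻ z in Metric.ball q.1 (q.2 : ℝ),
          ENNReal.ofReal (besselKernel n α (z - y)) * h y := by
        refine lintegral_lintegral_swap (Measurable.aemeasurable ?_)
        exact ((hG.comp (measurable_fst.sub measurable_snd)).ennreal_ofReal).mul
          (hh.comp measurable_snd)
    _ ≤ ∫⁻ y, (C * volume (Metric.ball q.1 (q.2 : ℝ))) *
          (ENNReal.ofReal (kernelMajorant n α (max (q.2 : ℝ) (dist q.1 y))) * h y) := by
        refine lintegral_mono fun y => ?_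
        have hGy : Measurable fun z => ENNReal.ofReal (besselKernel n α (z - y)) :=
          (hG.comp (by fun_prop : Measurable fun z => z - y)).ennreal_ofReal
        rw [lintegral_mul_const _ hGy]
        calc _ ≤ _ := mul_le_mul_left (hC q.1 y q.2 ht) (h y)
          _ = _ := by ring
    _ = _ := by
        rw [lintegral_const_mul']
        · ring
        · exact ENNReal.mul_ne_top ENNReal.coe_ne_top hVt

/-- Write N = N^(1/p) N^(1/q), bound the first factor by its supremum and apply Hölder to h and the
second. -/
lemma lintegral_mul_le_of_le {X : Type*} [MeasurableSpace X] {μ : Measure X} {p q : ℝ}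
    (hpq : p.HolderConjugate q) {h N : X → ℝ≥0∞} (hh : Measurable h) (hN : Measurable N)
    {b : ℝ≥0∞} (hb : ∀ x, N x ≤ b) :
    ∫⁻ x, h x * N x ∂μ ≤
      b ^ (1 / p) * ((∫⁻ x, h x ^ p ∂μ) ^ (1 / p) * (∫⁻ x, N x ∂μ) ^ (1 / q)) := by
  have hp := hpq.pos
  have hq := hpq.symm.pos
  have hsum : 1 / p + 1 / q = 1 := by simpa using hpq.one_div_add_one_div
  calc ∫⁻ x, h x * N x ∂μ ≤ ∫⁻ x, b ^ (1 / p) * (h * fun x => N x ^ (1 / q)) x ∂μ := by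
        refine lintegral_mono fun x => ?_
        calc h x * N x = h x * (N x ^ (1 / p) * N x ^ (1 / q)) := by
              rw [← ENNReal.rpow_add_of_nonneg _ _ (by positivity) (by positivity), hsum,
                ENNReal.rpow_one]
          _ ≤ h x * (b ^ (1 / p) * N x ^ (1 / q)) := by
              gcongr
              exact hb x
          _ = _ := by simp only [Pi.mul_apply]; ring
    _ = b ^ (1 / p) * ∫⁻ x, (h * fun x => N x ^ (1 / q)) x ∂μ :=
        lintegral_const_mul _ (hh.mul (hN.pow_const _))
    _ ≤ _ := by
        gcongr
        refine (ENNReal.lintegral_mul_le_Lp_mul_Lq μ hpq hh.aemeasurable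
          (hN.pow_const _).aemeasurable).trans_eq ?_
        simp_rw [← ENNReal.rpow_mul, one_div_mul_cancel hq.ne', ENNReal.rpow_one]

/-- This identity is why the weight has two regimes: rⁿ τ(r) = min(r,1)^α, while w(r) =
min(r,1)^(-αp) rⁿ. -/
lemma kernelMajorant_mul_rpow {q : ℝ} (hpq : p.HolderConjugate q) (hα0 : 0 ≤ α) {r : ℝ}
    (hr : 0 < r) :
    kernelMajorant n α r * (r ^ n) ^ (1 / q) = (wAlpha n α p r.toNNReal : ℝ) ^ (-(1 / p)) := by
  have hp := hpq.pos
  have hm : 0 < min r 1 := lt_min hr one_pos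
  have h1 : 1 / q = 1 + -(1 / p) := by
    have : 1 / p + 1 / q = 1 := by simpa using hpq.one_div_add_one_div
    linarith
  have h2 : ((min r.toNNReal 1 : ℝ≥0) : ℝ) = min r 1 := by
    rw [NNReal.coe_min, Real.coe_toNNReal _ hr.le, NNReal.coe_one]
  have h3 : min (r ^ α) 1 = (min r 1) ^ α := by
    rcases le_total r 1 with h | h
    · rw [min_eq_left h, min_eq_left (Real.rpow_le_one hr.le h hα0)]
    · rw [min_eq_right h, min_eq_right (Real.one_le_rpow h hα0), Real.one_rpow]
  rw [← rpow_min_one_mul_eq_wAlpha (Real.toNNReal_pos.2 hr), h2, Real.coe_toNNReal _ hr.le,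
    Real.mul_rpow (by positivity) (by positivity), ← Real.rpow_mul hm.le, h1,
    Real.rpow_add (by positivity), Real.rpow_one, ← mul_assoc, mul_comm _ (r ^ n),
    pow_mul_kernelMajorant hr, h3]
  congr 2
  field_simp

/-- Integration against the majorant, written as a superposition of cylinders. -/
lemma lintegral_kernelMajorant_le (hα0 : 0 ≤ α) (hα : α ≤ n) (ν : Measure (UpperSpace n))
    [IsFiniteMeasure ν] {h : EuclideanSpace ℝ (Fin n) → ℝ≥0∞} (hh : Measurable h) :
    ∫⁻ q, (∫⁻ y, ENNReal.ofReal (kernelMajorant n α (max (q.2 : ℝ) (dist q.1 y))) * h y) ∂ν ≤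
      2 ^ (n + 1) * ∫⁻ r in Ioi (0 : ℝ), ENNReal.ofReal (kernelMajorant n α r / r) *
        ∫⁻ y, h y * ν {q | max (q.2 : ℝ) (dist q.1 y) < r} := by
  let S : Set (UpperSpace n × EuclideanSpace ℝ (Fin n) × ℝ) :=
    {z | max (z.1.2 : ℝ) (dist z.1.1 z.2.1) < z.2.2}
  have hS : MeasurableSet S := by
    refine (isOpen_lt ?_ ?_).measurableSet <;> fun_prop
  let J : UpperSpace n × EuclideanSpace ℝ (Fin n) × ℝ → ℝ≥0∞ := fun z =>
    S.indicator (fun _ => 1) z * (ENNReal.ofReal (kernelMajorant n α z.2.2 / z.2.2) * h z.2.1)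
  have hJ : Measurable J := by
    refine (measurable_const.indicator hS).mul (Measurable.mul ?_ ?_)
    · exact ((measurable_kernelMajorant.comp (measurable_snd.comp measurable_snd)).div
        (measurable_snd.comp measurable_snd)).ennreal_ofReal
    · exact hh.comp (measurable_fst.comp measurable_snd)
  calc _ ≤ ∫⁻ q, (∫⁻ y, 2 ^ (n + 1) * ∫⁻ r in Ioi (0 : ℝ), J (q, y, r)) ∂ν := by
        refine lintegral_mono fun q => lintegral_mono fun y => ?_
        have hm : 0 < max (q.2 : ℝ) (dist q.1 y) := lt_max_of_lt_left q.2.2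
        have h1 : ∫⁻ r in Ioi (max (q.2 : ℝ) (dist q.1 y)),
            ENNReal.ofReal (kernelMajorant n α r / r) * h y ≤ ∫⁻ r in Ioi (0 : ℝ), J (q, y, r) := by
          rw [← lintegral_indicator measurableSet_Ioi, ← lintegral_indicator measurableSet_Ioi]
          refine lintegral_mono fun r => ?_
          by_cases hr : max (q.2 : ℝ) (dist q.1 y) < r
          · have hrS : (q, y, r) ∈ S := hr
            rw [indicator_of_mem (mem_Ioi.2 hr), indicator_of_mem (mem_Ioi.2 (hm.trans hr))]
            simp [J, hrS]
          · rw [indicator_of_notMem (by simpa using hr)]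
            exact zero_le (a := _)
        have h2 : Measurable fun r => ENNReal.ofReal (kernelMajorant n α r / r) := by fun_prop
        rw [lintegral_mul_const _ h2] at h1
        calc _ ≤ 2 ^ (n + 1) * (∫⁻ r in Ioi (max (q.2 : ℝ) (dist q.1 y)),
              ENNReal.ofReal (kernelMajorant n α r / r)) * h y :=
              mul_le_mul_left (kernelMajorant_le_setLIntegral hα0 hα hm) _
          _ ≤ _ := by
              rw [mul_assoc]
              gcongr
    _ = 2 ^ (n + 1) * ∫⁻ q, (∫⁻ y, ∫⁻ r in Ioi (0 : ℝ), J (q, y, r)) ∂ν := by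
        have h2 : (2 : ℝ≥0∞) ^ (n + 1) ≠ ∞ := ENNReal.pow_ne_top ENNReal.ofNat_ne_top
        simp_rw [lintegral_const_mul' _ _ h2]
    _ = 2 ^ (n + 1) * ∫⁻ q, (∫⁻ z, J (q, z)
          ∂(volume : Measure (EuclideanSpace ℝ (Fin n))).prod (volume.restrict (Ioi (0 : ℝ)))) ∂ν := by
        congr 1
        refine lintegral_congr fun q => ?_
        have hJq : Measurable fun z => J (q, z) := hJ.comp (by fun_prop)
        rw [lintegral_prod _ hJq.aemeasurable]
    _ = 2 ^ (n + 1) * ∫⁻ z, (∫⁻ q, J (q, z) ∂ν)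
          ∂(volume : Measure (EuclideanSpace ℝ (Fin n))).prod (volume.restrict (Ioi (0 : ℝ))) := by
        rw [lintegral_lintegral_swap (f := fun q z => J (q, z)) hJ.aemeasurable]
    _ = 2 ^ (n + 1) * ∫⁻ r in Ioi (0 : ℝ), ∫⁻ y, ∫⁻ q, J (q, y, r) ∂ν := by
        rw [lintegral_prod_symm _ (Measurable.aemeasurable ?_)]
        exact Measurable.lintegral_prod_left' hJ
    _ = _ := by
        congr 1
        refine lintegral_congr fun r => ?_
        rw [← lintegral_const_mul' _ _ ENNReal.ofReal_ne_top]
        refine lintegral_congr fun y => ?_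
        have hSr : MeasurableSet {q : UpperSpace n | max (q.2 : ℝ) (dist q.1 y) < r} := by
          refine (isOpen_lt ?_ ?_).measurableSet <;> fun_prop
        have hJi : ∀ q, J (q, y, r) = {q : UpperSpace n | max (q.2 : ℝ) (dist q.1 y) < r}.indicator
            (fun _ => 1) q * (ENNReal.ofReal (kernelMajorant n α r / r) * h y) := fun q => rfl
        simp_rw [hJi]
        rw [lintegral_mul_const _ (measurable_const.indicator hSr), lintegral_indicator hSr,
          setLIntegral_const]
        ring

lemma measurable_measure_cylinder (ν : Measure (UpperSpace n)) [IsFiniteMeasure ν] (r : ℝ) :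
    Measurable fun y : EuclideanSpace ℝ (Fin n) => ν {q | max (q.2 : ℝ) (dist q.1 y) < r} := by
  have hS : MeasurableSet {z : UpperSpace n × EuclideanSpace ℝ (Fin n) |
      max (z.1.2 : ℝ) (dist z.1.1 z.2) < r} := by
    refine (isOpen_lt ?_ ?_).measurableSet <;> fun_prop
  exact measurable_measure_prodMk_right hS

/-- By Tonelli each point of the half-space contributes at most the volume of a ball of radius r
around its base point. -/
lemma lintegral_measure_cylinder_le (ν : Measure (UpperSpace n)) [IsFiniteMeasure ν] {r : ℝ}
    (hr : 0 < r) :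
    ∫⁻ y : EuclideanSpace ℝ (Fin n), ν {q | max (q.2 : ℝ) (dist q.1 y) < r} ≤
      ν univ * (volume (Metric.ball (0 : EuclideanSpace ℝ (Fin n)) 1) * ENNReal.ofReal (r ^ n)) := by
  have hS : MeasurableSet {z : UpperSpace n × EuclideanSpace ℝ (Fin n) |
      max (z.1.2 : ℝ) (dist z.1.1 z.2) < r} := by
    refine (isOpen_lt ?_ ?_).measurableSet <;> fun_prop
  have h1 := Measure.prod_apply_symm (μ := ν) (ν := (volume : Measure (EuclideanSpace ℝ (Fin n)))) hS
  rw [Measure.prod_apply hS] at h1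
  refine h1.symm.le.trans ?_
  calc _ ≤ ∫⁻ _, volume (Metric.ball (0 : EuclideanSpace ℝ (Fin n)) r) ∂ν := by
        refine lintegral_mono fun q => ?_
        rw [← Measure.addHaar_ball_center volume q.1]
        refine measure_mono fun y hy => ?_
        rw [Metric.mem_ball, dist_comm]
        exact lt_of_le_of_lt (le_max_right _ _) hy
    _ = _ := by
        rw [lintegral_const, Measure.addHaar_ball_of_pos _ _ hr, finrank_euclideanSpace,
          Fintype.card_fin]
        ring

end CapacitaryEstimate

/-! ### The dual estimate and the Bessel capacity -/

section CapacitaryEstimate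

variable {n : ℕ} {α p : ℝ}

/-- The dual form of the capacitary estimate: a measure of mass `M ≈ Φ(s)` on the tent over `O`
that satisfies the Carleson condition forces `s ≤ C ‖h‖_p^p` whenever `G_α * h ≥ 1` on `O`. -/
lemma exists_rpow_le_of_carleson (hn : n ≠ 0) (hα0 : 0 < α) (hα : α < n) (hp : 1 < p)
    (hpn : α * p < n) {Φ : ℝ≥0 → ℝ≥0} (hmono : Monotone Φ) (hdil : DilationCondition Φ)
    (hdini : DiniCondition p Φ) {μ : Measure (UpperSpace n)}
    (hμ : μ ∈ CarlesonClass n (Φ ∘ wAlpha n α p)) (c : ℝ≥0) :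
    ∃ K : ℝ≥0, ∀ (O : Set (EuclideanSpace ℝ (Fin n))) (A : Set (UpperSpace n)),
      MeasurableSet A → A ⊆ tent O → ∀ s M : ℝ≥0, 0 < s → 0 < M → μ A = M → Φ s ≤ c * M →
      ∀ h : EuclideanSpace ℝ (Fin n) → ℝ≥0∞, Measurable h →
        (∀ᵐ z, z ∈ O → 1 ≤ ∫⁻ y, ENNReal.ofReal (besselKernel n α (z - y)) * h y) →
        (s : ℝ≥0∞) ^ (1 / p) ≤ K * (∫⁻ y, h y ^ p) ^ (1 / p) := by
  have hp0 : 0 < p := by linarith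
  set q := p.conjExponent with hq
  have hpq : p.HolderConjugate q := Real.HolderConjugate.conjExponent hp
  have hq0 := hpq.symm.pos
  have hsum : 1 / p + 1 / q = 1 := by simpa using hpq.one_div_add_one_div
  obtain ⟨C₁, hC₁⟩ := exists_one_le_lintegral_kernelMajorant hn hα0 hα
  obtain ⟨C₂, hC₂⟩ := exists_measure_tent_ball_le hmono hdil (by positivity) 2 one_le_two hμ
  obtain ⟨C₃, hC₃⟩ := exists_lintegral_min_wAlpha_le hn hpn hp0 hdini c
  set v := volume.real (Metric.ball (0 : EuclideanSpace ℝ (Fin n)) 1) with hv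
  have hvol : volume (Metric.ball (0 : EuclideanSpace ℝ (Fin n)) 1) = ENNReal.ofReal v :=
    (ofReal_measureReal measure_ball_lt_top.ne).symm
  have hv0 : 0 ≤ v := measureReal_nonneg
  -- A common constant for both bounds on the mass of a cylinder: the total mass M, and the Carleson
  -- bound C₂ Φ(w(r)) from the tent over the ball of radius 2r.
  set d : ℝ≥0 := max 1 C₂ with hd
  set w := wAlpha n α p
  set k : ℝ≥0 := d ^ (1 / p) * v.toNNReal ^ (1 / q) with hk
  -- The summand 1 keeps the constant nonzero, so that the bound is trivial when the norm of h is
  -- infinite.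
  refine ⟨C₁ * 2 ^ (n + 1) * k * C₃ + 1, fun O A hA hAO s M hs hM hμA hΦ h hh hO => ?_⟩
  have hs' : (0 : ℝ) < s := by exact_mod_cast hs
  have hM' : (0 : ℝ) < M := by exact_mod_cast hM
  set H := (∫⁻ y, h y ^ p) ^ (1 / p) with hH
  rcases eq_or_ne H ∞ with hH' | hH'
  · rw [hH', ENNReal.mul_top (by positivity)]
    exact le_top
  set ν := μ.restrict A with hν
  have hνu : ν univ = M := by rw [hν, Measure.restrict_apply_univ, hμA]
  have : IsFiniteMeasure ν := ⟨by rw [hνu]; exact ENNReal.coe_lt_top⟩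
  have hslice : ∀ r ∈ Ioi (0 : ℝ), ENNReal.ofReal (kernelMajorant n α r / r) *
      ∫⁻ y, h y * ν {q | max (q.2 : ℝ) (dist q.1 y) < r} ≤
      (k * (M : ℝ≥0∞) ^ (1 / q) * H) * (ENNReal.ofReal r⁻¹ * ENNReal.ofReal
        (((min M (Φ (w r.toNNReal)) : ℝ≥0) / w r.toNNReal : ℝ) ^ (1 / p))) := by
    intro r hr
    have hr0 : (0 : ℝ) < r := hr
    have hrn : 0 < r.toNNReal := Real.toNNReal_pos.2 hr0
    set b : ℝ≥0 := min M (Φ (w r.toNNReal)) with hb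
    have hN : ∀ y, ν {q | max (q.2 : ℝ) (dist q.1 y) < r} ≤ ((d * b : ℝ≥0) : ℝ≥0∞) := by
      intro y
      rw [hb, mul_min, ENNReal.coe_min]
      refine le_min ?_ ?_
      · refine (measure_mono (subset_univ _)).trans ?_
        rw [hνu, ENNReal.coe_le_coe]
        exact le_mul_of_one_le_left' (le_max_left _ _)
      · refine (Measure.restrict_apply_le _ _).trans ?_
        refine (measure_mono ?_).trans ((hC₂ y r.toNNReal hrn).trans ?_)
        · intro q hq
          refine mem_tent_ball ?_
          have h1 : (q.2 : ℝ) < r := (le_max_left _ _).trans_lt hq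
          have h2 : dist q.1 y < r := (le_max_right _ _).trans_lt hq
          rw [NNReal.coe_mul, Real.coe_toNNReal _ hr0.le]
          push_cast
          linarith
        · rw [ENNReal.coe_mul]
          gcongr
          exact le_max_right _ _
    have hw0 : 0 < (w r.toNNReal : ℝ) := by exact_mod_cast wAlpha_pos hrn
    calc _ ≤ ENNReal.ofReal (kernelMajorant n α r / r) * (((d * b : ℝ≥0) : ℝ≥0∞) ^ (1 / p) *
          (H * ((M : ℝ≥0∞) * (ENNReal.ofReal v * ENNReal.ofReal (r ^ n))) ^ (1 / q))) := by
          gcongr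
          refine (lintegral_mul_le_of_le hpq hh (measurable_measure_cylinder ν r) hN).trans ?_
          gcongr
          refine (lintegral_measure_cylinder_le ν hr0).trans_eq ?_
          rw [hνu, hvol]
      _ = (k * (M : ℝ≥0∞) ^ (1 / q) * H) * (ENNReal.ofReal (kernelMajorant n α r / r) *
          (ENNReal.ofReal ((b : ℝ) ^ (1 / p)) * ENNReal.ofReal ((r ^ n) ^ (1 / q)))) := by
          rw [ENNReal.mul_rpow_of_nonneg _ _ (by positivity : 0 ≤ 1 / q),
            ENNReal.mul_rpow_of_nonneg _ _ (by positivity : 0 ≤ 1 / q), ENNReal.coe_mul,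
            ENNReal.mul_rpow_of_nonneg _ _ (by positivity : 0 ≤ 1 / p), hk, ENNReal.coe_mul,
            ENNReal.coe_rpow_of_nonneg _ (by positivity : 0 ≤ 1 / p),
            ENNReal.coe_rpow_of_nonneg _ (by positivity : 0 ≤ 1 / q),
            ← ENNReal.ofReal_rpow_of_nonneg (by positivity) (by positivity : 0 ≤ 1 / p),
            ← ENNReal.ofReal_rpow_of_nonneg (by positivity) (by positivity : 0 ≤ 1 / q),
            ENNReal.ofReal_coe_nnreal]
          change _ = _ * ENNReal.ofReal v ^ (1 / q) * _ * _ * _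
          ring
      _ = _ := by
          congr 1
          have hτ := (kernelMajorant_pos (n := n) (α := α) hr0).le
          rw [← ENNReal.ofReal_mul (by positivity), ← ENNReal.ofReal_mul (by positivity),
            ← ENNReal.ofReal_mul (by positivity)]
          congr 1
          have hid := kernelMajorant_mul_rpow (n := n) hpq hα0.le hr0
          rw [Real.div_rpow b.coe_nonneg hw0.le, div_eq_mul_inv _ ((w r.toNNReal : ℝ) ^ (1 / p)),
            ← Real.rpow_neg hw0.le, ← hid]
          ring
  have hmain : (M : ℝ≥0∞) ≤ ((C₁ * 2 ^ (n + 1) * k * C₃ : ℝ≥0) : ℝ≥0∞) * H *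
      ((M : ℝ≥0∞) ^ (1 / q) * ENNReal.ofReal ((M / s : ℝ) ^ (1 / p))) := by
    calc (M : ℝ≥0∞) = ∫⁻ _, 1 ∂ν := by rw [lintegral_const, hνu, one_mul]
      _ ≤ ∫⁻ q, C₁ * (∫⁻ y, ENNReal.ofReal (kernelMajorant n α (max (q.2 : ℝ) (dist q.1 y))) *
            h y) ∂ν :=
          setLIntegral_mono' hA fun q hq => hC₁ O h hh hO q (hAO hq)
      _ = C₁ * ∫⁻ q, (∫⁻ y, ENNReal.ofReal (kernelMajorant n α (max (q.2 : ℝ) (dist q.1 y))) *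
            h y) ∂ν := lintegral_const_mul' _ _ ENNReal.coe_ne_top
      _ ≤ C₁ * (2 ^ (n + 1) * ∫⁻ r in Ioi (0 : ℝ), (k * (M : ℝ≥0∞) ^ (1 / q) * H) *
            (ENNReal.ofReal r⁻¹ * ENNReal.ofReal
            (((min M (Φ (w r.toNNReal)) : ℝ≥0) / w r.toNNReal : ℝ) ^ (1 / p)))) := by
          gcongr
          refine (lintegral_kernelMajorant_le hα0.le hα.le ν hh).trans ?_
          refine mul_le_mul_right ?_ _
          exact setLIntegral_mono' measurableSet_Ioi hslice
      _ ≤ C₁ * (2 ^ (n + 1) * ((k * (M : ℝ≥0∞) ^ (1 / q) * H) *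
            (C₃ * ENNReal.ofReal ((M / s : ℝ) ^ (1 / p))))) := by
          gcongr
          rw [lintegral_const_mul' _ _ (ENNReal.mul_ne_top (ENNReal.mul_ne_top
            ENNReal.coe_ne_top (ENNReal.rpow_ne_top_of_nonneg (by positivity)
            ENNReal.coe_ne_top)) hH')]
          gcongr
          exact hC₃ s M hs hΦ
      _ = _ := by push_cast; ring
  -- The exponents of M add up to 1, so M cancels from `hmain`; this uses that M is finite and
  -- positive.
  have hid : (M : ℝ≥0∞) ^ (1 / q) * ENNReal.ofReal ((M / s : ℝ) ^ (1 / p)) =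
      ((M / s ^ (1 / p) : ℝ≥0) : ℝ≥0∞) := by
    have h1 : (M : ℝ) ^ (1 / q) * ((M / s : ℝ) ^ (1 / p)) = ((M / s ^ (1 / p) : ℝ≥0) : ℝ) := by
      rw [Real.div_rpow hM'.le hs'.le, ← mul_div_assoc, ← Real.rpow_add hM', add_comm, hsum,
        Real.rpow_one]
      push_cast
      rfl
    rw [← ENNReal.ofReal_coe_nnreal (p := M), ENNReal.ofReal_rpow_of_nonneg hM'.le (by positivity),
      ← ENNReal.ofReal_mul (by positivity), h1, ENNReal.ofReal_coe_nnreal]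
  rw [hid] at hmain
  have hsp : 0 < s ^ (1 / p) := NNReal.rpow_pos hs
  calc (s : ℝ≥0∞) ^ (1 / p) = M * ((s ^ (1 / p) / M : ℝ≥0) : ℝ≥0∞) := by
        rw [← ENNReal.coe_mul, mul_div_cancel₀ _ hM.ne',
          ENNReal.coe_rpow_of_nonneg _ (by positivity)]
    _ ≤ _ := mul_le_mul_left hmain _
    _ = ((C₁ * 2 ^ (n + 1) * k * C₃ : ℝ≥0) : ℝ≥0∞) * H := by
        rw [mul_assoc _ (((M / s ^ (1 / p) : ℝ≥0)) : ℝ≥0∞), ← ENNReal.coe_mul,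
          div_mul_div_cancel₀ hsp.ne', div_self hM.ne', ENNReal.coe_one, mul_one]
    _ ≤ _ := by
        gcongr
        exact le_self_add

lemma one_le_lintegral_besselKernel_mul {g : EuclideanSpace ℝ (Fin n) → ℝ} (hα : α < n)
    {z : EuclideanSpace ℝ (Fin n)} (h : 1 ≤ besselPotential n α g z) :
    1 ≤ ∫⁻ y, ENNReal.ofReal (besselKernel n α (z - y)) * ‖g y‖ₑ := by
  calc (1 : ℝ≥0∞) = ENNReal.ofReal 1 := ENNReal.ofReal_one.symm
    _ ≤ ENNReal.ofReal (besselPotential n α g z) := ENNReal.ofReal_le_ofReal h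
    _ ≤ ‖besselPotential n α g z‖ₑ := Real.ofReal_le_enorm _
    _ ≤ ∫⁻ y, ‖besselKernel n α (z - y) * g y‖ₑ := enorm_integral_le_lintegral_enorm _
    _ = _ := by
        refine lintegral_congr fun y => ?_
        rw [enorm_mul, Real.enorm_eq_ofReal (besselKernel_nonneg hα _)]

/-- An admissible f is a.e. the potential of some g, and |g| serves as h, since the kernel is
nonnegative. Using K + 1 in place of K permits division. -/
lemma le_mul_besselCapacity (hα : α < n) (hp : 0 < p) {O : Set (EuclideanSpace ℝ (Fin n))}
    {K : ℝ≥0} {s : ℝ≥0∞}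
    (h : ∀ h : EuclideanSpace ℝ (Fin n) → ℝ≥0∞, Measurable h →
      (∀ᵐ z, z ∈ O → 1 ≤ ∫⁻ y, ENNReal.ofReal (besselKernel n α (z - y)) * h y) →
        s ^ (1 / p) ≤ K * (∫⁻ y, h y ^ p) ^ (1 / p)) :
    s ≤ ((K + 1) ^ p : ℝ≥0) * besselCapacity n α p O := by
  have hK0 : ((K + 1 : ℝ≥0) : ℝ≥0∞) ≠ 0 := by
    rw [ENNReal.coe_ne_zero]; positivity
  have hKt : ((K + 1 : ℝ≥0) : ℝ≥0∞) ≠ ∞ := ENNReal.coe_ne_top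
  have hKp : (((K + 1) ^ p : ℝ≥0) : ℝ≥0∞) = ((K + 1 : ℝ≥0) : ℝ≥0∞) ^ p :=
    ENNReal.coe_rpow_of_nonneg _ hp.le
  have h0 : ((K + 1 : ℝ≥0) : ℝ≥0∞) ^ p ≠ 0 := by simp
  have ht : ((K + 1 : ℝ≥0) : ℝ≥0∞) ^ p ≠ ∞ := ENNReal.rpow_ne_top_of_nonneg hp.le hKt
  rw [hKp, ← ENNReal.div_le_iff' h0 ht]
  refine le_iInf fun f => le_iInf fun _ => le_iInf fun hf1 => ?_
  have hnorm : s ^ (1 / p) / ((K + 1 : ℝ≥0) : ℝ≥0∞) ≤ besselNorm n α p f := by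
    refine le_iInf fun g => le_iInf fun hg => le_iInf fun hfg => ?_
    rw [ENNReal.div_le_iff' hK0 hKt]
    set g' := hg.1.mk g with hg'
    have hgg' : g =ᵐ[volume] g' := hg.1.ae_eq_mk
    have h1 := h (fun y => ‖g' y‖ₑ) hg.1.stronglyMeasurable_mk.measurable.enorm ?_
    · refine h1.trans ?_
      rw [eLpNorm_congr_ae hgg', eLpNorm_eq_lintegral_rpow_enorm_toReal (by simpa using hp)
        ENNReal.ofReal_ne_top, ENNReal.toReal_ofReal hp.le]
      gcongr
      exact le_self_add
    · filter_upwards [hfg] with z hz hzO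
      refine (one_le_lintegral_besselKernel_mul hα (hz ▸ hf1 z hzO)).trans_eq ?_
      refine lintegral_congr_ae ?_
      filter_upwards [hgg'] with y hy
      rw [hy]
  calc s / ((K + 1 : ℝ≥0) : ℝ≥0∞) ^ p = (s ^ (1 / p) / ((K + 1 : ℝ≥0) : ℝ≥0∞)) ^ p := by
        rw [ENNReal.div_rpow_of_nonneg _ _ hp.le, ← ENNReal.rpow_mul, one_div_mul_cancel hp.ne',
          ENNReal.rpow_one]
    _ ≤ _ := by gcongr

/-- An increasing gauge comparable to Ψ may jump over values, so `hrange` asks only that every M be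
comparable to some Φ(s). -/
lemma carlesonClass_subset_capClass_besselCapacity (hn : n ≠ 0) (hα0 : 0 < α) (hα : α < n)
    (hp : 1 < p) (hpn : α * p < n) {Φ : ℝ≥0 → ℝ≥0} (hmono : Monotone Φ)
    (hdil : DilationCondition Φ) (hdini : DiniCondition p Φ) {c : ℝ≥0}
    (hrange : ∀ M : ℝ≥0, ∃ s, Φ s ≤ c * M ∧ M ≤ c * Φ s) :
    CarlesonClass n (Φ ∘ wAlpha n α p) ⊆ CapClass Φ (besselCapacity n α p) := by
  intro μ hμ
  have hp0 : 0 < p := by linarith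
  obtain ⟨K, hK⟩ := exists_rpow_le_of_carleson hn hα0 hα hp hpn hmono hdil hdini hμ c
  obtain ⟨d, hd⟩ := hdil.2 ((K + 1) ^ p) (NNReal.rpow_pos (by positivity))
  refine ⟨c * d, fun O hO hcap => ?_⟩
  set κ := (besselCapacity n α p O).toNNReal with hκ
  have hκ' : besselCapacity n α p O = κ := (ENNReal.coe_toNNReal hcap).symm
  -- The tent may have infinite mass a priori. Each truncation lies in the tent over a ball, so the
  -- Carleson condition makes its mass finite; the bound is uniform in N.
  let A : ℕ → Set (UpperSpace n) := fun N => tent O ∩ {q | dist q.1 0 + (q.2 : ℝ) < N + 1}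
  have hAm : ∀ N, MeasurableSet (A N) := fun N => by
    refine (isOpen_tent hO).measurableSet.inter (isOpen_lt ?_ ?_).measurableSet <;> fun_prop
  have hAmono : Monotone A := fun N N' hNN' q hq => by
    have h1 : dist q.1 0 + (q.2 : ℝ) < N + 1 := hq.2
    have h2 : (N : ℝ) ≤ N' := by exact_mod_cast hNN'
    exact ⟨hq.1, h1.trans_le (by linarith)⟩
  have hAU : ⋃ N, A N = tent O := by
    rw [← inter_iUnion, inter_eq_left]
    intro q _
    obtain ⟨N, hN⟩ := exists_nat_gt (dist q.1 0 + (q.2 : ℝ))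
    exact mem_iUnion.2 ⟨N, hN.trans (lt_add_one _)⟩
  have hA : ∀ N, μ (A N) ≤ ((c * d : ℝ≥0) : ℝ≥0∞) * Φ κ := by
    intro N
    have hfin : μ (A N) ≠ ∞ := by
      obtain ⟨e, he⟩ := hμ
      refine ne_top_of_le_ne_top ?_ ((measure_mono ?_).trans (he 0 (N + 1) (by positivity)))
      · exact ENNReal.mul_ne_top ENNReal.coe_ne_top ENNReal.coe_ne_top
      · intro q hq
        refine mem_tent_ball ?_
        push_cast
        exact hq.2
    obtain ⟨M, hM : (M : ℝ≥0∞) = μ (A N)⟩ := WithTop.ne_top_iff_exists.1 hfin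
    obtain ⟨s, hs1, hs2⟩ := hrange M
    rcases eq_or_lt_of_le (zero_le (a := M)) with h0 | hM0
    · rw [← hM, ← h0]; exact zero_le (a := _)
    have hs0 : 0 < s := by
      rcases eq_or_lt_of_le (zero_le (a := s)) with h0 | h0
      · rw [← h0, hdil.1, mul_zero] at hs2
        exact absurd hs2 (not_le.2 hM0)
      · exact h0
    have hsκ : s ≤ (K + 1) ^ p * κ := by
      have := le_mul_besselCapacity hα hp0 (O := O) (K := K) (s := s) fun h hh hhO =>
        hK O (A N) (hAm N) inter_subset_left s M hs0 hM0 hM.symm hs1 h hh hhO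
      rw [hκ'] at this
      exact_mod_cast this
    rw [← hM]
    have h1 := (hd κ).1
    simp only at h1
    have h2 : M ≤ c * (d * Φ κ) := hs2.trans (by gcongr; exact (hmono hsκ).trans h1)
    rw [← mul_assoc] at h2
    exact_mod_cast h2
  rw [← hAU, hAmono.measure_iUnion]
  exact iSup_le hA

end CapacitaryEstimate

section Transfer

variable {n : ℕ} {Φ Ψ : ℝ≥0 → ℝ≥0}

lemma capClass_congr (h : Comparable Φ Ψ) (cap : Set (EuclideanSpace ℝ (Fin n)) → ℝ≥0∞) :
    CapClass Φ cap = CapClass Ψ cap := by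
  have key : ∀ {X Y : ℝ≥0 → ℝ≥0}, Comparable X Y → CapClass X cap ⊆ CapClass Y cap := by
    rintro X Y ⟨d, hd⟩ μ ⟨c, hc⟩
    refine ⟨c * d, fun O hO hcap => (hc O hO hcap).trans ?_⟩
    rw [ENNReal.coe_mul, mul_assoc]
    gcongr
    exact_mod_cast (hd _).1
  exact (key h).antisymm (key h.symm)

lemma carlesonClass_congr (h : Comparable Φ Ψ) : CarlesonClass n Φ = CarlesonClass n Ψ := by
  have key : ∀ {X Y : ℝ≥0 → ℝ≥0}, Comparable X Y → CarlesonClass n X ⊆ CarlesonClass n Y := by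
    rintro X Y ⟨d, hd⟩ μ ⟨c, hc⟩
    refine ⟨c * d, fun x r hr => (hc x r hr).trans ?_⟩
    rw [ENNReal.coe_mul, mul_assoc]
    gcongr
    exact_mod_cast (hd _).1
  exact (key h).antisymm (key h.symm)

end Transfer

theorem mainTheorem7 (n : ℕ) (α p : ℝ) (hα : 0 < α) (hp : 1 < p) (hpn : p < n / α)
    (Ψ : ℝ≥0 → ℝ≥0) (hΨ_onto : Function.Surjective Ψ)
    (hΨ_incr : ∃ Ψ' : ℝ≥0 → ℝ≥0, StrictMono Ψ' ∧ Comparable Ψ Ψ')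
    (hΨ_dil : DilationCondition Ψ) (hΨ_dini : DiniCondition p Ψ) :
    CapClass Ψ (hausdorffCapacity n (wAlpha n α p)) = CapClass Ψ (besselCapacity n α p) ∧
    CapClass Ψ (besselCapacity n α p) = CarlesonClass n (Ψ ∘ wAlpha n α p) := by
  obtain ⟨Φ, hΦ, hΨΦ⟩ := hΨ_incr
  have hmono := hΦ.monotone
  have hp0 : 0 < p := by linarith
  have hαpn : α * p < n := by rwa [lt_div_iff₀ hα, mul_comm] at hpn
  have hαp : 0 < α * p := by positivity
  have hαn : α < n := lt_of_le_of_lt (le_mul_of_one_le_right hα.le hp.le) hαpn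
  have hn : n ≠ 0 := by
    rintro rfl
    rw [Nat.cast_zero] at hαn
    linarith
  have hdil := hΨ_dil.of_comparable hΨΦ
  have hdini := hΨ_dini.of_comparable hp0 hΨΦ
  have hcomp : Comparable (Ψ ∘ wAlpha n α p) (Φ ∘ wAlpha n α p) := by
    obtain ⟨c, hc⟩ := hΨΦ
    exact ⟨c, fun s => hc _⟩
  rw [capClass_congr hΨΦ, capClass_congr hΨΦ, carlesonClass_congr hcomp]
  have hH : CapClass Φ (hausdorffCapacity n (wAlpha n α p)) =
      CarlesonClass n (Φ ∘ wAlpha n α p) := by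
    refine Subset.antisymm (capClass_subset_carlesonClass hmono hdil (k := 1) fun x r hr => ?_)
      (carlesonClass_subset_capClass_hausdorffCapacity hn hαp.le hp0 hmono hdil hdini)
    simpa using hausdorffCapacity_ball_le x hr
  have hB : CapClass Φ (besselCapacity n α p) = CarlesonClass n (Φ ∘ wAlpha n α p) := by
    obtain ⟨k, hk⟩ := exists_besselCapacity_ball_le hn hα hαn hp0
    obtain ⟨c, hc⟩ := hΨΦ
    refine Subset.antisymm (capClass_subset_carlesonClass hmono hdil hk)
      (carlesonClass_subset_capClass_besselCapacity hn hα hαn hp hαpn hmono hdil hdini (c := c)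
        fun M => ?_)
    -- Surjectivity of Ψ enters only here.
    obtain ⟨s, rfl⟩ := hΨ_onto M
    exact ⟨s, (hc s).2, (hc s).1⟩
  exact ⟨hH.trans hB.symm, hB⟩
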